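/- Let $p:\mathbb{R}^d\to[1,\infty)$ be measurable with $1<p^-\le p(y)\le p^+<\infty$ for all $y$, where $p^-,p^+$ are the essential infimum and supremum of $p$, and let $\vartheta:\mathbb{R}^d\to(0,\infty)$ be measurable and locally integrable with $\vartheta^{-1/(p(\cdot)-1)}\in L^1_{loc}(\mathbb{R}^d)$. For $\Omega\subset\mathbb{R}^d$ open, let $W^{1,p(\cdot)}_\vartheta(\Omega)$ be the space of functions $f$ on $\Omega$ for which $f$ and its weak gradient's length $|\nabla f|$ have finite Luxemburg norm $\inf\{\lambda>0:\int_\Omega|h(y)/\lambda|^{p(y)}\vartheta(y)\,dy\le1\}$. For $K\subset\Omega$ compact put $$\mathrm{cap}^*(K,\Omega)=\inf_f\int_\Omega|\nabla f(y)|^{p(y)}\vartheta(y)\,dy,$$ the infimum being over all $f\in W^{1,p(\cdot)}_\vartheta(\Omega)$ that are continuous with compact support in $\Omega$ and satisfy $f\ge0$ and $f>1$ on $K$. For $U\subset\Omega$ open put $\mathrm{cap}(U,\Omega)=\sup\{\mathrm{cap}^*(K,\Omega):K\subset U\text{ compact}\}$, and for arbitrary $E\subset\Omega$ put $\mathrm{cap}(E,\Omega)=\inf\{\mathrm{cap}(U,\Omega):E\subset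 U\subset\Omega,\ U\text{ open}\}$. Let $B(x,r)$ denote the open Euclidean ball. A set $E\subset\mathbb{R}^d$ is called $(p(\cdot),\vartheta)$-thin at $x$ if $$\int_0^1\left(\frac{\mathrm{cap}(E\cap B(x,r),B(x,2r))}{\mathrm{cap}(B(x,r),B(x,2r))}\right)^{\frac1{p(x)-1}}\frac{dr}{r}<\infty,$$ where the quotient is read as $1$ if its denominator is $0$. **Theorem.** Let $x_0\in\mathbb{R}^d$, $0<r\le s\le 2r$, $A\subset B(x_0,r)$ and $\mathrm{cap}(A,B(x_0,4r))\ge1$. Assume that $A$ is $(p(\cdot),\vartheta)$-thin at a point $x\in\overline A\setminus A$. Then there is an open set $U\supset A$ such that $U$ is $(p(\cdot),\vartheta)$-thin at $x$ and $x\notin U$. -/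

import Mathlib

open MeasureTheory Set
open scoped ENNReal InnerProductSpace

namespace VarCap

noncomputable section

/-- `p⁻`, the essential infimum of the exponent with respect to Lebesgue measure. -/
def pMinus {d : ℕ} (p : EuclideanSpace ℝ (Fin d) → ℝ) : ℝ := essInf p volume

/-- `p⁺`, the essential supremum of the exponent with respect to Lebesgue measure. -/
def pPlus {d : ℕ} (p : EuclideanSpace ℝ (Fin d) → ℝ) : ℝ := essSup p volume

/-- The weighted modular `∫_Ω |f(y)|^{p(y)} ϑ(y) dy`, with values in `[0, ∞]`. -/
def modular {d : ℕ} (p ϑ : EuclideanSpace ℝ (Fin d) → ℝ) (Ω : Set (EuclideanSpace ℝ (Fin d)))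
    (f : EuclideanSpace ℝ (Fin d) → ℝ) : ℝ≥0∞ :=
  ∫⁻ y in Ω, ENNReal.ofReal (|f y| ^ p y * ϑ y)

/-- Membership in the weighted variable exponent Lebesgue space over `Ω`: `f` is measurable on `Ω`
and its Luxemburg norm `inf {l > 0 : modular (f / l) ≤ 1}` is finite, that is, the set of such `l`
is nonempty. -/
def MemLpVar {d : ℕ} (p ϑ : EuclideanSpace ℝ (Fin d) → ℝ) (Ω : Set (EuclideanSpace ℝ (Fin d)))
    (f : EuclideanSpace ℝ (Fin d) → ℝ) : Prop :=
  AEMeasurable f (volume.restrict Ω) ∧ ∃ l : ℝ, 0 < l ∧ modular p ϑ Ω (fun y => f y / l) ≤ 1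

/-- `g` is a weak (distributional) gradient of `f` in the open set `Ω`. -/
def IsWeakGradient {d : ℕ} (Ω : Set (EuclideanSpace ℝ (Fin d)))
    (f : EuclideanSpace ℝ (Fin d) → ℝ)
    (g : EuclideanSpace ℝ (Fin d) → EuclideanSpace ℝ (Fin d)) : Prop :=
  LocallyIntegrableOn f Ω ∧ LocallyIntegrableOn g Ω ∧
    ∀ φ : EuclideanSpace ℝ (Fin d) → ℝ, ContDiff ℝ (⊤ : ℕ∞) φ → HasCompactSupport φ →
      tsupport φ ⊆ Ω →
      ∀ v : EuclideanSpace ℝ (Fin d),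
        ∫ y in Ω, f y * fderiv ℝ φ y v = - ∫ y in Ω, ⟪g y, v⟫_ℝ * φ y

/-- `f` belongs to the weighted variable exponent Sobolev space of first order over the open set
`Ω`, and `g` is its weak gradient there. -/
def MemSobolev {d : ℕ} (p ϑ : EuclideanSpace ℝ (Fin d) → ℝ) (Ω : Set (EuclideanSpace ℝ (Fin d)))
    (f : EuclideanSpace ℝ (Fin d) → ℝ)
    (g : EuclideanSpace ℝ (Fin d) → EuclideanSpace ℝ (Fin d)) : Prop :=
  IsWeakGradient Ω f g ∧ MemLpVar p ϑ Ω f ∧ MemLpVar p ϑ Ω (fun y => ‖g y‖)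

/-- `f` is a Sobolev function over `Ω` with weak gradient `g`, continuous with compact support in
`Ω` (and extended by zero outside `Ω`), nonnegative, and `f > 1` on `K`. -/
def Admissible {d : ℕ} (p ϑ : EuclideanSpace ℝ (Fin d) → ℝ)
    (K Ω : Set (EuclideanSpace ℝ (Fin d)))
    (f : EuclideanSpace ℝ (Fin d) → ℝ)
    (g : EuclideanSpace ℝ (Fin d) → EuclideanSpace ℝ (Fin d)) : Prop :=
  MemSobolev p ϑ Ω f g ∧ Continuous f ∧ HasCompactSupport f ∧ tsupport f ⊆ Ω ∧
    (∀ y ∈ K, 1 < f y) ∧ ∀ y, 0 ≤ f y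

/-- The capacity `cap*` of a compact set `K ⊆ Ω` relative to the open set `Ω`. The weak gradient is
unique up to null sets, so that the infimum over `g` is no additional minimisation. -/
def capCompact {d : ℕ} (p ϑ : EuclideanSpace ℝ (Fin d) → ℝ)
    (K Ω : Set (EuclideanSpace ℝ (Fin d))) : ℝ≥0∞ :=
  ⨅ (f : EuclideanSpace ℝ (Fin d) → ℝ)
    (g : EuclideanSpace ℝ (Fin d) → EuclideanSpace ℝ (Fin d))
    (_ : Admissible p ϑ K Ω f g), modular p ϑ Ω (fun y => ‖g y‖)

/-- The capacity of an open set `U ⊆ Ω` relative to the open set `Ω`. -/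
def capOpen {d : ℕ} (p ϑ : EuclideanSpace ℝ (Fin d) → ℝ)
    (U Ω : Set (EuclideanSpace ℝ (Fin d))) : ℝ≥0∞ :=
  ⨆ (K : Set (EuclideanSpace ℝ (Fin d))) (_ : IsCompact K) (_ : K ⊆ U), capCompact p ϑ K Ω

/-- The relative `(p(·), ϑ)`-capacity of an arbitrary set `E ⊆ Ω` relative to the open set `Ω`. -/
def relCap {d : ℕ} (p ϑ : EuclideanSpace ℝ (Fin d) → ℝ)
    (E Ω : Set (EuclideanSpace ℝ (Fin d))) : ℝ≥0∞ :=
  ⨅ (U : Set (EuclideanSpace ℝ (Fin d))) (_ : IsOpen U) (_ : E ⊆ U) (_ : U ⊆ Ω), capOpen p ϑ U Ω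

open Classical in
/-- The quotient `cap(E ∩ B(x,r), B(x,2r)) / cap(B(x,r), B(x,2r))`, with the convention that it is
`1` if the denominator vanishes. -/
def capRatio {d : ℕ} (p ϑ : EuclideanSpace ℝ (Fin d) → ℝ)
    (E : Set (EuclideanSpace ℝ (Fin d))) (x : EuclideanSpace ℝ (Fin d)) (r : ℝ) : ℝ≥0∞ :=
  if relCap p ϑ (Metric.ball x r) (Metric.ball x (2 * r)) = 0 then 1
  else relCap p ϑ (E ∩ Metric.ball x r) (Metric.ball x (2 * r)) /
    relCap p ϑ (Metric.ball x r) (Metric.ball x (2 * r))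

/-- The Wiener integral `∫_0^1 (capRatio E x r)^{1/(p(x)-1)} dr/r`. -/
def wienerIntegral {d : ℕ} (p ϑ : EuclideanSpace ℝ (Fin d) → ℝ)
    (E : Set (EuclideanSpace ℝ (Fin d))) (x : EuclideanSpace ℝ (Fin d)) : ℝ≥0∞ :=
  ∫⁻ r in Ioo (0 : ℝ) 1, capRatio p ϑ E x r ^ (1 / (p x - 1)) * ENNReal.ofReal (1 / r)

/-- `E` is `(p(·), ϑ)`-thin at `x`. -/
def IsThin {d : ℕ} (p ϑ : EuclideanSpace ℝ (Fin d) → ℝ)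
    (E : Set (EuclideanSpace ℝ (Fin d))) (x : EuclideanSpace ℝ (Fin d)) : Prop :=
  wienerIntegral p ϑ E x < ∞

end

end VarCap

open Filter Topology

/-! By the definition of `relCap`, each single radius `r` has an open set containing `A ∩ B(x, r)`
of nearly the same capacity. The difficulty is to find one open `U` for all radii, since passing to
a slightly smaller radius shrinks the reference ball and so may raise the capacity.

The analytic core is `IsExponentWeight.exists_capOpen_le`: if `V` lies in a compact subset of `Ω`,
then its capacity relative to `Ω` is almost attained with supports in one compact subset of `Ω`, so
a slightly smaller reference set costs little. To see this, fix a compact `K₁ ⊆ V` of almost full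
capacity with an almost optimal `v`. For any compact `K ⊆ V`, an almost optimal `w` for `K ∪ K₁` has
a midpoint with `v` that still competes for `K₁`. Uniform convexity then makes the energy of `w - v`
small, and a Poincaré-type bound makes its modular small. With a cutoff `χ` equal to `1` near the
compact set containing `V`, the function `v + χ (w - v)` equals `w` on `K`, has almost the same
energy as `v`, and is supported in a compact set independent of `K`.

Hence an open set chosen at radius `r` also serves an interval of radii to the left of `r`
(`exists_isControlled_left`). The radii not interior to an interval served by a single set are
countably many for each rational level, so countably many rational triples `(α, β, q)` with open
sets `V m` recover the capacity at almost every radius. On each dyadic shell, dominated convergence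
leaves finitely many triples with error `2 ^ (-j)`. Finally `U` consists of the points other than
`x` that, for every `j`, lie in each of the finitely many `V m` of scale `j` unless they are too far
from `x` for that scale. Away from `x` only finitely many conditions are active, so `U` is open, and
the errors form a convergent series. -/

namespace VarCap

/-! ### Compactly supported functions with a global weak gradient -/

/-- A continuous function `f` vanishing off the compact set `S`, together with an integrable
global weak gradient `g` vanishing off `S`. -/
structure IsTestPair {d : ℕ} (S : Set (EuclideanSpace ℝ (Fin d)))
    (f : EuclideanSpace ℝ (Fin d) → ℝ)
    (g : EuclideanSpace ℝ (Fin d) → EuclideanSpace ℝ (Fin d)) : Prop where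
  isCompact : IsCompact S
  continuous : Continuous f
  fun_eq_zero : ∀ y ∉ S, f y = 0
  grad_eq_zero : ∀ y ∉ S, g y = 0
  integrable_grad : Integrable g
  weak : ∀ φ : EuclideanSpace ℝ (Fin d) → ℝ, ContDiff ℝ (⊤ : ℕ∞) φ → HasCompactSupport φ →
    ∀ v : EuclideanSpace ℝ (Fin d), ∫ y, f y * fderiv ℝ φ y v = - ∫ y, ⟪g y, v⟫_ℝ * φ y

theorem exists_smooth_cutoff {d : ℕ} {K U : Set (EuclideanSpace ℝ (Fin d))} (hK : IsCompact K)
    (hU : IsOpen U) (hKU : K ⊆ U) :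
    ∃ χ : EuclideanSpace ℝ (Fin d) → ℝ, ContDiff ℝ (⊤ : ℕ∞) χ ∧ HasCompactSupport χ ∧
      tsupport χ ⊆ U ∧ (∀ᶠ y in 𝓝ˢ K, χ y = 1) ∧ ∀ y, χ y ∈ Icc (0 : ℝ) 1 := by
  obtain ⟨L, hL, hKL, hLU⟩ := exists_compact_between hK hU hKU
  obtain ⟨f, h1, h0, hf⟩ := exists_contMDiffMap_one_nhds_of_subset_interior (n := (⊤ : ℕ∞))
    (modelWithCornersSelf ℝ (EuclideanSpace ℝ (Fin d))) hK.isClosed hKL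
  have hs : tsupport f ⊆ L := by
    refine closure_minimal (fun y hy => ?_) hL.isClosed
    by_contra hyL
    exact hy (h0 y hyL)
  exact ⟨f, f.contMDiff.contDiff, HasCompactSupport.of_support_subset_isCompact hL
    ((subset_tsupport _).trans hs), hs.trans hLU, h1, hf⟩

namespace IsTestPair

variable {d : ℕ} {S S' : Set (EuclideanSpace ℝ (Fin d))}
  {f f₁ f₂ : EuclideanSpace ℝ (Fin d) → ℝ}
  {g g₁ g₂ : EuclideanSpace ℝ (Fin d) → EuclideanSpace ℝ (Fin d)}

theorem mono (h : IsTestPair S f g) (hS' : IsCompact S') (hSS' : S ⊆ S') :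
    IsTestPair S' f g where
  isCompact := hS'
  continuous := h.continuous
  fun_eq_zero y hy := h.fun_eq_zero y fun hyS => hy (hSS' hyS)
  grad_eq_zero y hy := h.grad_eq_zero y fun hyS => hy (hSS' hyS)
  integrable_grad := h.integrable_grad
  weak := h.weak

theorem hasCompactSupport (h : IsTestPair S f g) : HasCompactSupport f :=
  HasCompactSupport.intro h.isCompact fun y hy => h.fun_eq_zero y hy

theorem tsupport_subset (h : IsTestPair S f g) : tsupport f ⊆ S :=
  closure_minimal (fun y hy => by_contra fun hyS => hy (h.fun_eq_zero y hyS)) h.isCompact.isClosed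

theorem integrable (h : IsTestPair S f g) : Integrable f :=
  h.continuous.integrable_of_hasCompactSupport h.hasCompactSupport

theorem integrable_mul (h : IsTestPair S f g) {φ : EuclideanSpace ℝ (Fin d) → ℝ}
    (hφ : Continuous φ) : Integrable fun y => f y * φ y :=
  (h.continuous.mul hφ).integrable_of_hasCompactSupport h.hasCompactSupport.mul_right

theorem integrable_inner_mul (h : IsTestPair S f g) {φ : EuclideanSpace ℝ (Fin d) → ℝ}
    (hφ : Continuous φ) (hc : HasCompactSupport φ) (v : EuclideanSpace ℝ (Fin d)) :
    Integrable fun y => ⟪g y, v⟫_ℝ * φ y := by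
  obtain ⟨C, hC⟩ := hφ.bounded_above_of_compact_support hc
  exact (h.integrable_grad.inner_const v).mul_bdd (c := C) hφ.aestronglyMeasurable (ae_of_all _ hC)

theorem continuous_fderiv_apply {φ : EuclideanSpace ℝ (Fin d) → ℝ}
    (hφ : ContDiff ℝ (⊤ : ℕ∞) φ) (v : EuclideanSpace ℝ (Fin d)) :
    Continuous fun y => fderiv ℝ φ y v :=
  (hφ.continuous_fderiv (by simp)).clm_apply continuous_const

theorem linearComb (h₁ : IsTestPair S f₁ g₁) (h₂ : IsTestPair S f₂ g₂) (a b : ℝ) :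
    IsTestPair S (fun y => a * f₁ y + b * f₂ y) (fun y => a • g₁ y + b • g₂ y) where
  isCompact := h₁.isCompact
  continuous := (continuous_const.mul h₁.continuous).add (continuous_const.mul h₂.continuous)
  fun_eq_zero y hy := by simp [h₁.fun_eq_zero y hy, h₂.fun_eq_zero y hy]
  grad_eq_zero y hy := by simp [h₁.grad_eq_zero y hy, h₂.grad_eq_zero y hy]
  integrable_grad := (h₁.integrable_grad.smul a).add (h₂.integrable_grad.smul b)
  weak φ hφ hc v := by
    have e1 : ∀ y, (a * f₁ y + b * f₂ y) * fderiv ℝ φ y v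
        = a * (f₁ y * fderiv ℝ φ y v) + b * (f₂ y * fderiv ℝ φ y v) := fun y => by ring
    have e2 : ∀ y, ⟪a • g₁ y + b • g₂ y, v⟫_ℝ * φ y
        = a * (⟪g₁ y, v⟫_ℝ * φ y) + b * (⟪g₂ y, v⟫_ℝ * φ y) := fun y => by
      rw [inner_add_left, real_inner_smul_left, real_inner_smul_left]; ring
    simp_rw [e1, e2]
    have hd := continuous_fderiv_apply hφ v
    rw [integral_add ((h₁.integrable_mul hd).const_mul a) ((h₂.integrable_mul hd).const_mul b),
      integral_add ((h₁.integrable_inner_mul hφ.continuous hc v).const_mul a)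
        ((h₂.integrable_inner_mul hφ.continuous hc v).const_mul b)]
    simp_rw [integral_const_mul]
    rw [h₁.weak φ hφ hc v, h₂.weak φ hφ hc v]; ring

theorem gradient_eq_zero_of_notMem_tsupport {χ : EuclideanSpace ℝ (Fin d) → ℝ}
    {y : EuclideanSpace ℝ (Fin d)} (hy : y ∉ tsupport χ) : gradient χ y = 0 := by
  have : fderiv ℝ χ y = 0 := by
    by_contra h
    exact hy (support_fderiv_subset ℝ h)
  simp [gradient, this]

theorem continuous_gradient {χ : EuclideanSpace ℝ (Fin d) → ℝ}
    (hχ : ContDiff ℝ (⊤ : ℕ∞) χ) : Continuous (gradient χ) :=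
  (InnerProductSpace.toDual ℝ (EuclideanSpace ℝ (Fin d))).symm.continuous.comp
    (hχ.continuous_fderiv (by simp))

/-- The factor `χ` moves onto the test function: `χ ∂φ = ∂(χ φ) - φ ∂χ`, and `χ φ` is again a test
function for `f`. -/
theorem mul_smooth (h : IsTestPair S f g) {χ : EuclideanSpace ℝ (Fin d) → ℝ}
    (hχ : ContDiff ℝ (⊤ : ℕ∞) χ) (hχc : HasCompactSupport χ) :
    IsTestPair (tsupport χ) (fun y => χ y * f y) (fun y => χ y • g y + f y • gradient χ y) where
  isCompact := hχc
  continuous := hχ.continuous.mul h.continuous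
  fun_eq_zero y hy := by simp [image_eq_zero_of_notMem_tsupport hy]
  grad_eq_zero y hy := by
    simp [image_eq_zero_of_notMem_tsupport hy, gradient_eq_zero_of_notMem_tsupport hy]
  integrable_grad := by
    obtain ⟨C, hC⟩ := hχ.continuous.bounded_above_of_compact_support hχc
    refine (h.integrable_grad.bdd_smul C hχ.continuous.aestronglyMeasurable (ae_of_all _ hC)).add ?_
    exact (h.continuous.smul (continuous_gradient hχ)).integrable_of_hasCompactSupport
      h.hasCompactSupport.smul_right
  weak φ hφ hc v := by
    have hd := continuous_fderiv_apply hφ v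
    have hd' := continuous_fderiv_apply hχ v
    have e1 : ∀ y, χ y * f y * fderiv ℝ φ y v
        = f y * fderiv ℝ (fun z => χ z * φ z) y v - f y * (φ y * fderiv ℝ χ y v) := fun y => by
      rw [fderiv_fun_mul (hχ.differentiable (by simp) y) (hφ.differentiable (by simp) y)]
      simp only [add_apply, smul_apply, smul_eq_mul]
      ring
    have e2 : ∀ y, ⟪χ y • g y + f y • gradient χ y, v⟫_ℝ * φ y
        = ⟪g y, v⟫_ℝ * (χ y * φ y) + f y * (φ y * fderiv ℝ χ y v) := fun y => by
      have : ⟪gradient χ y, v⟫_ℝ = fderiv ℝ χ y v := by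
        simp [gradient, InnerProductSpace.toDual_symm_apply]
      rw [inner_add_left, real_inner_smul_left, real_inner_smul_left, this]; ring
    simp_rw [e1, e2]
    have i3 : Integrable fun y => f y * (φ y * fderiv ℝ χ y v) :=
      h.integrable_mul (hφ.continuous.mul hd')
    have i4 : Integrable fun y => ⟪g y, v⟫_ℝ * (χ y * φ y) :=
      h.integrable_inner_mul (hχ.continuous.mul hφ.continuous) hc.mul_left v
    rw [integral_sub (h.integrable_mul (continuous_fderiv_apply (hχ.mul hφ) v)) i3,
      integral_add i4 i3]
    have key := h.weak (fun z => χ z * φ z) (hχ.mul hφ) hc.mul_left v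
    rw [key]
    ring

end IsTestPair

/-! ### Translations and a Poincaré-type inequality -/

variable {d : ℕ}

theorem hasDerivAt_integral_mul_translate {h ψ : EuclideanSpace ℝ (Fin d) → ℝ}
    (hh : Integrable h) (hψ : ContDiff ℝ (⊤ : ℕ∞) ψ) (hc : HasCompactSupport ψ)
    (v : EuclideanSpace ℝ (Fin d)) (t : ℝ) :
    HasDerivAt (fun t : ℝ => ∫ y, h y * ψ (y + t • v))
      (∫ y, h y * fderiv ℝ ψ (y + t • v) v) t := by
  obtain ⟨C₀, hC₀⟩ := hψ.continuous.bounded_above_of_compact_support hc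
  obtain ⟨C, hC⟩ := (hψ.continuous_fderiv (by simp)).bounded_above_of_compact_support
    (hc.fderiv (𝕜 := ℝ))
  have hcont : ∀ t : ℝ, Continuous fun y => ψ (y + t • v) := fun t =>
    hψ.continuous.comp (continuous_id.add continuous_const)
  refine (hasDerivAt_integral_of_dominated_loc_of_deriv_le
    (F := fun (t : ℝ) y => h y * ψ (y + t • v))
    (F' := fun (t : ℝ) y => h y * fderiv ℝ ψ (y + t • v) v) (s := univ)
    (bound := fun y => ‖h y‖ * (C * ‖v‖)) univ_mem ?_ ?_ ?_ ?_ ?_ ?_).2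
  · exact Eventually.of_forall fun t =>
      hh.aestronglyMeasurable.mul (hcont t).aestronglyMeasurable
  · exact hh.mul_bdd (c := C₀) (hcont t).aestronglyMeasurable (ae_of_all _ fun y => hC₀ _)
  · refine hh.aestronglyMeasurable.mul (Continuous.aestronglyMeasurable ?_)
    exact (IsTestPair.continuous_fderiv_apply hψ v).comp (continuous_id.add continuous_const)
  · refine ae_of_all _ fun y t _ => ?_
    rw [norm_mul]
    gcongr
    exact (ContinuousLinearMap.le_opNorm _ _).trans (by gcongr; exact hC _)
  · exact hh.norm.mul_const _
  · refine ae_of_all _ fun y t _ => ?_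
    have h1 : HasFDerivAt ψ (fderiv ℝ ψ (y + t • v)) (y + t • v) :=
      (hψ.differentiable (by simp) _).hasFDerivAt
    have h2 : HasDerivAt (fun t : ℝ => y + t • v) v t := by
      simpa using ((hasDerivAt_id t).smul_const v).const_add y
    exact (h1.comp_hasDerivAt t h2).const_mul _

namespace IsTestPair

variable {S : Set (EuclideanSpace ℝ (Fin d))}
  {f : EuclideanSpace ℝ (Fin d) → ℝ} {g : EuclideanSpace ℝ (Fin d) → EuclideanSpace ℝ (Fin d)}

theorem translate_estimate_smooth (h : IsTestPair S f g) {ψ : EuclideanSpace ℝ (Fin d) → ℝ}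
    (hψ : ContDiff ℝ (⊤ : ℕ∞) ψ) (hc : HasCompactSupport ψ) (v : EuclideanSpace ℝ (Fin d))
    {t ω : ℝ} (ht : 0 ≤ t) (hω : ∀ s ∈ Icc 0 t, ∀ y, |ψ (y + s • v) - ψ y| ≤ ω) :
    |(∫ y, f y * ψ (y + t • v)) - (∫ y, f y * ψ y) + t * ∫ y, ⟪g y, v⟫_ℝ * ψ y|
      ≤ t * ((∫ y, ‖g y‖) * ‖v‖ * ω) := by
  have hcs : ∀ s : ℝ, HasCompactSupport fun y => ψ (y + s • v) := fun s =>
    hc.comp_homeomorph (Homeomorph.addRight (s • v))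
  have hsm : ∀ s : ℝ, ContDiff ℝ (⊤ : ℕ∞) fun y => ψ (y + s • v) := fun s =>
    hψ.comp (contDiff_id.add contDiff_const)
  -- The weak gradient identity, applied to the translated `ψ`, cancels all but an oscillation of
  -- `ψ`; the mean value inequality then gives the bound.
  have hderiv : ∀ s : ℝ, HasDerivAt
      (fun t : ℝ => (∫ y, f y * ψ (y + t • v)) + t * ∫ y, ⟪g y, v⟫_ℝ * ψ y)
      (∫ y, ⟪g y, v⟫_ℝ * (ψ y - ψ (y + s • v))) s := fun s => by
    have h1 := hasDerivAt_integral_mul_translate h.integrable hψ hc v s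
    have h2 := (hasDerivAt_id s).mul_const (∫ y, ⟪g y, v⟫_ℝ * ψ y)
    have e : ∫ y, f y * fderiv ℝ ψ (y + s • v) v = - ∫ y, ⟪g y, v⟫_ℝ * ψ (y + s • v) := by
      rw [← h.weak _ (hsm s) (hcs s) v]
      simp_rw [fderiv_comp_add_right]
    refine (h1.add h2).congr_deriv ?_
    rw [e]
    simp_rw [mul_sub]
    rw [integral_sub (h.integrable_inner_mul hψ.continuous hc v)
      (h.integrable_inner_mul (hsm s).continuous (hcs s) v)]
    ring
  have key := (convex_Icc (0 : ℝ) t).norm_image_sub_le_of_norm_hasDerivWithin_le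
    (f := fun t : ℝ => (∫ y, f y * ψ (y + t • v)) + t * ∫ y, ⟪g y, v⟫_ℝ * ψ y)
    (C := (∫ y, ‖g y‖) * ‖v‖ * ω) (x := 0) (y := t)
    (fun s _ => (hderiv s).hasDerivWithinAt) (fun s hs => ?_) ⟨le_rfl, ht⟩ ⟨ht, le_rfl⟩
  · simp only [zero_smul, add_zero, zero_mul, Real.norm_eq_abs, sub_zero, abs_of_nonneg ht] at key
    rw [mul_comm t (_ * _)]
    rwa [show (∫ y, f y * ψ (y + t • v)) - (∫ y, f y * ψ y) + t * ∫ y, ⟪g y, v⟫_ℝ * ψ y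
      = (∫ y, f y * ψ (y + t • v)) + t * (∫ y, ⟪g y, v⟫_ℝ * ψ y) - ∫ y, f y * ψ y by ring]
  · calc ‖∫ y, ⟪g y, v⟫_ℝ * (ψ y - ψ (y + s • v))‖
        ≤ ∫ y, ‖g y‖ * (‖v‖ * ω) := by
          refine norm_integral_le_of_norm_le (h.integrable_grad.norm.mul_const _)
            (ae_of_all _ fun y => ?_)
          rw [norm_mul, ← mul_assoc]
          gcongr
          · exact norm_inner_le_norm _ _
          · rw [norm_sub_rev]; exact hω s hs y
      _ = (∫ y, ‖g y‖) * ‖v‖ * ω := by rw [integral_mul_const, mul_assoc]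

/-- A quantitative first-order expansion of translations against a continuous function. -/
theorem translate_estimate (h : IsTestPair S f g) {ψ : EuclideanSpace ℝ (Fin d) → ℝ}
    (hψ : Continuous ψ) (hc : HasCompactSupport ψ) (v : EuclideanSpace ℝ (Fin d))
    {t ω : ℝ} (ht : 0 ≤ t) (hω : ∀ s ∈ Icc 0 t, ∀ y, |ψ (y + s • v) - ψ y| ≤ ω) :
    |(∫ y, f y * ψ (y + t • v)) - (∫ y, f y * ψ y) + t * ∫ y, ⟪g y, v⟫_ℝ * ψ y|
      ≤ t * ((∫ y, ‖g y‖) * ‖v‖ * ω) := by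
  set F := ∫ y, ‖f y‖
  set G := ∫ y, ‖g y‖
  have lim : ContinuousWithinAt (fun ε : ℝ => t * (G * ‖v‖ * (ω + 2 * ε)) +
      (F * ε + F * ε + t * (G * ‖v‖ * ε))) (Ioi 0) 0 := by fun_prop
  have lim' := lim.tendsto
  simp only [mul_zero, add_zero] at lim'
  refine ge_of_tendsto lim' (eventually_mem_nhdsWithin.mono fun ε (hε : 0 < ε) => ?_)
  -- A smooth `φ` within `ε` of `ψ` has oscillation at most `ω + 2 * ε`; all other errors are linear
  -- in `ε`, which tends to `0`.
  obtain ⟨φ, hφ, hφψ, hsupp⟩ := hψ.exists_contDiff_approx (⊤ : ℕ∞) (ε := fun _ => ε)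
    continuous_const (fun _ => hε)
  have hφc : HasCompactSupport φ := hc.mono hsupp
  have hd : ∀ y, |φ y - ψ y| ≤ ε := fun y => (hφψ y).le
  have key := h.translate_estimate_smooth hφ hφc v ht (ω := ω + 2 * ε) fun s hs y => by
    have h1 := abs_le.1 (hd y)
    have h2 := abs_le.1 (hd (y + s • v))
    have h3 := abs_le.1 (hω s hs y)
    exact abs_le.2 ⟨by linarith, by linarith⟩
  have tr : Continuous fun y : EuclideanSpace ℝ (Fin d) => y + t • v :=
    continuous_id.add continuous_const
  have b1 : |(∫ y, f y * ψ (y + t • v)) - ∫ y, f y * φ (y + t • v)| ≤ F * ε := by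
    have i1 : Integrable fun y => f y * ψ (y + t • v) := h.integrable_mul (hψ.comp tr)
    have i2 : Integrable fun y => f y * φ (y + t • v) := h.integrable_mul (hφ.continuous.comp tr)
    rw [← integral_sub i1 i2, ← integral_mul_const, ← Real.norm_eq_abs]
    refine norm_integral_le_of_norm_le (h.integrable.norm.mul_const _) (ae_of_all _ fun y => ?_)
    rw [← mul_sub, norm_mul, norm_sub_rev]
    gcongr
    exact hd _
  have b2 : |(∫ y, f y * ψ y) - ∫ y, f y * φ y| ≤ F * ε := by
    rw [← integral_sub (h.integrable_mul hψ) (h.integrable_mul hφ.continuous),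
      ← integral_mul_const, ← Real.norm_eq_abs]
    refine norm_integral_le_of_norm_le (h.integrable.norm.mul_const _) (ae_of_all _ fun y => ?_)
    rw [← mul_sub, norm_mul, norm_sub_rev]
    gcongr
    exact hd _
  have b3 : |(∫ y, ⟪g y, v⟫_ℝ * ψ y) - ∫ y, ⟪g y, v⟫_ℝ * φ y| ≤ G * ‖v‖ * ε := by
    rw [← integral_sub (h.integrable_inner_mul hψ hc v)
      (h.integrable_inner_mul hφ.continuous hφc v), mul_assoc,
      ← integral_mul_const, ← Real.norm_eq_abs]
    refine norm_integral_le_of_norm_le (h.integrable_grad.norm.mul_const _)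
      (ae_of_all _ fun y => ?_)
    rw [← mul_sub, norm_mul, norm_sub_rev, ← mul_assoc]
    gcongr
    · exact norm_inner_le_norm _ _
    · exact hd _
  have b3' : |t * (∫ y, ⟪g y, v⟫_ℝ * ψ y) - t * ∫ y, ⟪g y, v⟫_ℝ * φ y| ≤ t * (G * ‖v‖ * ε) := by
    rw [← mul_sub, abs_mul, abs_of_nonneg ht]
    gcongr
  rw [abs_le] at *
  constructor <;> linarith [b1.1, b1.2, b2.1, b2.2, b3'.1, b3'.2, key.1, key.2]

/-- The `L²` norm of a bounded test function is controlled by the `L¹` norm of its gradient. -/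
theorem integral_sq_le (h : IsTestPair S f g) {v x : EuclideanSpace ℝ (Fin d)} {R : ℝ}
    (hv : ‖v‖ = 1) (hR : 0 ≤ R) (hS : S ⊆ Metric.closedBall x R) {M : ℝ} (hM : ∀ y, |f y| ≤ M) :
    ∫ y, f y ^ 2 ≤ (2 * R + 1) * (3 * M) * ∫ y, ‖g y‖ := by
  have hM0 : 0 ≤ M := (abs_nonneg _).trans (hM x)
  -- The expansion is tested against `f` itself. A shift by `2 * R + 1` moves the support off
  -- itself, so the product with the translate vanishes; the oscillation `2 * M` and the first-order
  -- term `M` add up to `3 * M`.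
  have key := h.translate_estimate h.continuous h.hasCompactSupport v (t := 2 * R + 1)
    (ω := 2 * M) (by positivity) fun s _ y => by
      have h1 := abs_le.1 (hM y)
      have h2 := abs_le.1 (hM (y + s • v))
      exact abs_le.2 ⟨by linarith, by linarith⟩
  have z : ∀ y, f y * f (y + (2 * R + 1) • v) = 0 := fun y => by
    by_contra hne
    have h1 : y ∈ S := by_contra fun hy => hne (by simp [h.fun_eq_zero y hy])
    have h2 : y + (2 * R + 1) • v ∈ S := by_contra fun hy => hne (by simp [h.fun_eq_zero _ hy])
    have h3 := dist_triangle_right (y + (2 * R + 1) • v) y x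
    have h4 : dist (y + (2 * R + 1) • v) y = 2 * R + 1 := by
      rw [dist_eq_norm, add_sub_cancel_left, norm_smul, hv, mul_one, Real.norm_eq_abs,
        abs_of_nonneg (by positivity)]
    linarith [Metric.mem_closedBall.1 (hS h1), Metric.mem_closedBall.1 (hS h2)]
  have b : |∫ y, ⟪g y, v⟫_ℝ * f y| ≤ (∫ y, ‖g y‖) * M := by
    rw [← integral_mul_const, ← Real.norm_eq_abs]
    refine norm_integral_le_of_norm_le (h.integrable_grad.norm.mul_const _)
      (ae_of_all _ fun y => ?_)
    rw [norm_mul]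
    gcongr
    · simpa [hv] using norm_inner_le_norm (𝕜 := ℝ) (g y) v
    · exact hM y
  have hG : 0 ≤ ∫ y, ‖g y‖ := integral_nonneg fun y => norm_nonneg _
  simp only [z, integral_zero, hv, mul_one] at key
  simp_rw [sq]
  have b' := mul_le_mul_of_nonneg_left (abs_le.1 b).2 (show (0 : ℝ) ≤ 2 * R + 1 by positivity)
  nlinarith [(abs_le.1 key).1]

end IsTestPair

/-! ### A smooth truncation and its chain rule -/

/-- The derivative of the truncation `truncate`. -/
noncomputable def truncateDeriv (u : ℝ) : ℝ := max 0 (min 1 (2 - u))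

/-- A `C¹` truncation: the identity on `[0, 1]` and bounded by `2`. -/
noncomputable def truncate (s : ℝ) : ℝ := ∫ u in (0 : ℝ)..s, truncateDeriv u

/-- The difference quotient of `truncate`. -/
noncomputable def truncateSlope (a b : ℝ) : ℝ := ∫ u in (0 : ℝ)..1, truncateDeriv (a + (b - a) * u)

theorem continuous_truncateDeriv : Continuous truncateDeriv := by
  unfold truncateDeriv; fun_prop

theorem truncateDeriv_nonneg (u : ℝ) : 0 ≤ truncateDeriv u := le_max_left _ _

theorem truncateDeriv_le_one (u : ℝ) : truncateDeriv u ≤ 1 :=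
  max_le zero_le_one (min_le_left _ _)

theorem abs_truncateDeriv_sub_le (a b : ℝ) : |truncateDeriv a - truncateDeriv b| ≤ |a - b| := by
  unfold truncateDeriv
  calc |max 0 (min 1 (2 - a)) - max 0 (min 1 (2 - b))|
      ≤ |min 1 (2 - a) - min 1 (2 - b)| := by
        simpa using abs_max_sub_max_le_max (0 : ℝ) (min 1 (2 - a)) 0 (min 1 (2 - b))
    _ ≤ |(2 - a) - (2 - b)| := by
        simpa using abs_min_sub_min_le_max (1 : ℝ) (2 - a) 1 (2 - b)
    _ = |a - b| := by rw [← abs_neg]; congr 1; ring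

theorem intervalIntegrable_truncateDeriv (a b : ℝ) :
    IntervalIntegrable truncateDeriv volume a b :=
  continuous_truncateDeriv.intervalIntegrable a b

theorem truncate_zero : truncate 0 = 0 := by simp [truncate]

theorem truncate_sub (a b : ℝ) : truncate b - truncate a = ∫ u in a..b, truncateDeriv u :=
  intervalIntegral.integral_interval_sub_left (intervalIntegrable_truncateDeriv _ _)
    (intervalIntegrable_truncateDeriv _ _)

theorem truncate_mono : Monotone truncate := fun a b hab => by
  have := truncate_sub a b
  have h2 := intervalIntegral.integral_nonneg (μ := volume) hab fun u _ => truncateDeriv_nonneg u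
  linarith

theorem truncate_nonneg {s : ℝ} (hs : 0 ≤ s) : 0 ≤ truncate s :=
  truncate_zero ▸ truncate_mono hs

theorem continuous_truncate : Continuous truncate :=
  intervalIntegral.continuous_primitive (fun a b => intervalIntegrable_truncateDeriv a b) 0

theorem truncate_le_two {s : ℝ} : truncate s ≤ 2 := by
  have h2 : truncate 2 ≤ 2 := by
    have h := intervalIntegral.integral_mono_on (μ := volume) (zero_le_two (α := ℝ))
      (intervalIntegrable_truncateDeriv 0 2) (intervalIntegrable_const (c := (1 : ℝ)))
      fun u _ => truncateDeriv_le_one u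
    simpa [truncate] using h
  rcases le_total s 2 with hs | hs
  · exact (truncate_mono hs).trans h2
  · have h3 := truncate_sub 2 s
    have h4 : ∫ u in (2 : ℝ)..s, truncateDeriv u = ∫ u in (2 : ℝ)..s, (0 : ℝ) := by
      refine intervalIntegral.integral_congr fun u hu => ?_
      rw [uIcc_of_le hs] at hu
      have : 2 - u ≤ 0 := by linarith [hu.1]
      simp [truncateDeriv, this]
    simp only [intervalIntegral.integral_zero] at h4
    linarith

theorem one_lt_truncate {s : ℝ} (hs : 1 < s) : 1 < truncate s := by
  have h1 : truncate 1 = 1 := by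
    have : ∫ u in (0 : ℝ)..1, truncateDeriv u = ∫ u in (0 : ℝ)..1, (1 : ℝ) := by
      refine intervalIntegral.integral_congr fun u hu => ?_
      rw [uIcc_of_le zero_le_one] at hu
      have : (1 : ℝ) ≤ 2 - u := by linarith [hu.2]
      simp [truncateDeriv, this]
    simpa [truncate] using this
  have hm : 1 < min s 2 := lt_min hs one_lt_two
  have h2 : 0 < ∫ u in (1 : ℝ)..min s 2, truncateDeriv u := by
    refine intervalIntegral.intervalIntegral_pos_of_pos_on (intervalIntegrable_truncateDeriv _ _)
      (fun u hu => ?_) hm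
    have : 0 < 2 - u := by linarith [hu.2, min_le_right s 2]
    exact lt_max_of_lt_right (lt_min one_pos this)
  have h3 := truncate_sub 1 (min s 2)
  have h4 := truncate_mono (min_le_left s 2)
  linarith

theorem truncate_sub_eq_mul (a b : ℝ) :
    truncate b - truncate a = (b - a) * truncateSlope a b := by
  rw [truncate_sub, truncateSlope, intervalIntegral.mul_integral_comp_add_mul]
  simp

/-- `truncateDeriv` is 1-Lipschitz, so its average between `a` and `b` differs from its value at `a`
by at most `|b - a|`. This is why the truncation is taken `C¹`. -/
theorem abs_truncateSlope_sub_le (a b : ℝ) : |truncateSlope a b - truncateDeriv a| ≤ |b - a| := by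
  have hi : IntervalIntegrable (fun u => truncateDeriv (a + (b - a) * u)) volume 0 1 :=
    (continuous_truncateDeriv.comp (by fun_prop)).intervalIntegrable _ _
  have e : truncateSlope a b - truncateDeriv a
      = ∫ u in (0 : ℝ)..1, (truncateDeriv (a + (b - a) * u) - truncateDeriv a) := by
    rw [intervalIntegral.integral_sub hi intervalIntegrable_const]
    simp [truncateSlope]
  rw [e]
  have := intervalIntegral.norm_integral_le_of_norm_le_const (a := (0 : ℝ)) (b := 1) (C := |b - a|)
    (f := fun u => truncateDeriv (a + (b - a) * u) - truncateDeriv a) fun u hu => by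
      rw [uIoc_of_le zero_le_one] at hu
      refine (abs_truncateDeriv_sub_le _ _).trans ?_
      rw [add_sub_cancel_left, abs_mul, abs_of_pos hu.1]
      exact mul_le_of_le_one_right (abs_nonneg _) hu.2
  simpa using this

theorem continuous_truncateSlope_comp {X : Type*} [TopologicalSpace X] {a b : X → ℝ}
    (ha : Continuous a) (hb : Continuous b) : Continuous fun y => truncateSlope (a y) (b y) := by
  unfold truncateSlope
  refine intervalIntegral.continuous_parametric_intervalIntegral_of_continuous' ?_ 0 1
  exact continuous_truncateDeriv.comp (by fun_prop)

namespace IsTestPair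

variable {S : Set (EuclideanSpace ℝ (Fin d))}
  {f : EuclideanSpace ℝ (Fin d) → ℝ} {g : EuclideanSpace ℝ (Fin d) → EuclideanSpace ℝ (Fin d)}

theorem exists_translate_le {ψ : EuclideanSpace ℝ (Fin d) → ℝ} (hψ : Continuous ψ)
    (hc : HasCompactSupport ψ) (v : EuclideanSpace ℝ (Fin d)) {ε : ℝ} (hε : 0 < ε) :
    ∃ δ > 0, ∀ t : ℝ, |t| < δ → ∀ y, |ψ (y + t • v) - ψ y| ≤ ε := by
  obtain ⟨δ, hδ, h⟩ := Metric.uniformContinuous_iff.1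
    (hc.uniformContinuous_of_continuous hψ) ε hε
  refine ⟨δ / (‖v‖ + 1), by positivity, fun t ht y => (h ?_).le⟩
  rw [lt_div_iff₀ (by positivity)] at ht
  rw [dist_eq_norm, add_sub_cancel_left, norm_smul, Real.norm_eq_abs]
  nlinarith [abs_nonneg t]

/-- The chain rule for the truncation. -/
theorem truncate (h : IsTestPair S f g) :
    IsTestPair S (fun y => truncate (f y)) (fun y => truncateDeriv (f y) • g y) where
  isCompact := h.isCompact
  continuous := continuous_truncate.comp h.continuous
  fun_eq_zero y hy := by simp [h.fun_eq_zero y hy, truncate_zero]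
  grad_eq_zero y hy := by simp [h.grad_eq_zero y hy]
  integrable_grad := h.integrable_grad.bdd_smul (C := 1)
    (continuous_truncateDeriv.comp h.continuous).aestronglyMeasurable
    (ae_of_all _ fun y => by
      rw [Function.comp_apply, Real.norm_eq_abs, abs_of_nonneg (truncateDeriv_nonneg _)]
      exact truncateDeriv_le_one _)
  weak φ hφ hc v := by
    set T : EuclideanSpace ℝ (Fin d) → ℝ := fun y => VarCap.truncate (f y)
    have hT : Continuous T := continuous_truncate.comp h.continuous
    have hTc : HasCompactSupport T :=
      HasCompactSupport.intro h.isCompact fun y hy => by simp [T, h.fun_eq_zero y hy, truncate_zero]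
    set ψ : EuclideanSpace ℝ (Fin d) → ℝ := fun y => truncateDeriv (f y) * φ y with hψ_def
    have hψ : Continuous ψ := (continuous_truncateDeriv.comp h.continuous).mul hφ.continuous
    have hψc : HasCompactSupport ψ := hc.mul_left
    have e : ∀ y, ⟪truncateDeriv (f y) • g y, v⟫_ℝ * φ y = ⟪g y, v⟫_ℝ * ψ y := fun y => by
      rw [real_inner_smul_left, hψ_def]; ring
    simp_rw [e]
    obtain ⟨C, hC⟩ := hφ.continuous.bounded_above_of_compact_support hc
    have hC0 : 0 ≤ C := (norm_nonneg _).trans (hC 0)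
    set G := (∫ y, ‖g y‖) * ‖v‖
    have hG : 0 ≤ G := mul_nonneg (integral_nonneg fun y => norm_nonneg _) (norm_nonneg _)
    have hderiv := hasDerivAt_integral_mul_translate
      (hT.integrable_of_hasCompactSupport hTc) hφ hc v 0
    have lim := hderiv.tendsto_slope_zero_right
    simp only [zero_smul, add_zero, zero_add, smul_eq_mul] at lim
    -- The right derivative at `0` of the pairing with translates is one side of the weak identity;
    -- it remains to compute the same limit from the weak gradient of `f`.
    suffices H : Tendsto (fun t : ℝ => t⁻¹ * ((∫ y, T y * φ (y + t • v)) - ∫ y, T y * φ y))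
        (𝓝[>] 0) (𝓝 (- ∫ y, ⟪g y, v⟫_ℝ * ψ y)) from tendsto_nhds_unique lim H
    rw [Metric.tendsto_nhds]
    intro ε hε
    obtain ⟨η, hη, hηε⟩ : ∃ η > 0, (G + G) * ((2 * C + 1) * η) < ε := by
      refine ⟨ε / ((G + G + 1) * (2 * C + 1)), by positivity, ?_⟩
      rw [show (G + G) * ((2 * C + 1) * (ε / ((G + G + 1) * (2 * C + 1))))
        = (G + G) * ε / (G + G + 1) by field_simp, div_lt_iff₀ (by positivity)]
      nlinarith
    obtain ⟨δ₁, hδ₁, H₁⟩ := exists_translate_le h.continuous h.hasCompactSupport v hη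
    obtain ⟨δ₂, hδ₂, H₂⟩ := exists_translate_le hψ hψc v hη
    filter_upwards [Ioo_mem_nhdsGT (lt_min hδ₁ hδ₂)] with t ht
    have ht0 : 0 < t := ht.1
    -- With the difference quotient of the truncation absorbed into the test function, increments of
    -- `T` become increments of `f`. As `ψt` is merely continuous, `translate_estimate` is needed in
    -- its nonsmooth form.
    set ψt : EuclideanSpace ℝ (Fin d) → ℝ :=
      fun y => truncateSlope (f y) (f (y - t • v)) * φ y with hψt_def
    have hfs : Continuous fun y => f (y - t • v) := h.continuous.comp (by fun_prop)
    have hψt : Continuous ψt :=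
      (continuous_truncateSlope_comp h.continuous hfs).mul hφ.continuous
    have hψtc : HasCompactSupport ψt := hc.mul_left
    have hclose : ∀ y, |ψt y - ψ y| ≤ η * C := fun y => by
      rw [hψt_def, hψ_def]
      dsimp only
      rw [← sub_mul, abs_mul]
      refine mul_le_mul ((abs_truncateSlope_sub_le _ _).trans ?_) (hC y) (abs_nonneg _) hη.le
      have := H₁ (-t) (by rw [abs_neg, abs_of_pos ht0]; exact ht.2.trans_le (min_le_left _ _)) y
      simpa [sub_eq_add_neg] using this
    have key := h.translate_estimate hψt hψtc v (ω := (2 * C + 1) * η) ht0.le fun s hs y => by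
      have h1 := abs_le.1 (hclose y)
      have h2 := abs_le.1 (hclose (y + s • v))
      have h3 := abs_le.1 (H₂ s (by
        rw [abs_of_nonneg hs.1]; exact (hs.2.trans_lt ht.2).trans_le (min_le_right _ _)) y)
      exact abs_le.2 ⟨by linarith, by linarith⟩
    have b : |(∫ y, ⟪g y, v⟫_ℝ * ψt y) - ∫ y, ⟪g y, v⟫_ℝ * ψ y| ≤ G * (η * C) := by
      rw [← integral_sub (h.integrable_inner_mul hψt hψtc v) (h.integrable_inner_mul hψ hψc v),
        mul_assoc, ← integral_mul_const, ← Real.norm_eq_abs]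
      refine norm_integral_le_of_norm_le (h.integrable_grad.norm.mul_const _)
        (ae_of_all _ fun y => ?_)
      rw [← mul_sub, norm_mul, ← mul_assoc]
      gcongr
      · exact norm_inner_le_norm _ _
      · exact hclose _
    have i0 : ∀ {a b : EuclideanSpace ℝ (Fin d) → ℝ}, Continuous a → Continuous b →
        HasCompactSupport b → Integrable fun y => a y * b y := fun ha hb hbc =>
      (ha.mul hb).integrable_of_hasCompactSupport hbc.mul_left
    have shift : ∀ {a b : EuclideanSpace ℝ (Fin d) → ℝ},
        ∫ y, a y * b (y + t • v) = ∫ y, a (y - t • v) * b y := fun {a b} => by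
      rw [← integral_sub_right_eq_self (fun y => a y * b (y + t • v)) (t • v)]
      simp
    have hTs : Continuous fun y => T (y - t • v) := hT.comp (by fun_prop)
    have eq1 : (∫ y, T y * φ (y + t • v)) - ∫ y, T y * φ y
        = (∫ y, f y * ψt (y + t • v)) - ∫ y, f y * ψt y := by
      rw [shift, shift, ← integral_sub (i0 hTs hφ.continuous hc) (i0 hT hφ.continuous hc),
        ← integral_sub (i0 hfs hψt hψtc) (i0 h.continuous hψt hψtc)]
      refine integral_congr_ae (ae_of_all _ fun y => ?_)
      dsimp only
      rw [← sub_mul, ← sub_mul, hψt_def, ← mul_assoc, ← truncate_sub_eq_mul]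
    rw [eq1, Real.dist_eq]
    set X := (∫ y, f y * ψt (y + t • v)) - ∫ y, f y * ψt y
    have key2 : |t⁻¹ * X + ∫ y, ⟪g y, v⟫_ℝ * ψt y| ≤ G * ((2 * C + 1) * η) := by
      have : t⁻¹ * X + ∫ y, ⟪g y, v⟫_ℝ * ψt y = t⁻¹ * (X + t * ∫ y, ⟪g y, v⟫_ℝ * ψt y) := by
        field_simp
      rw [this, abs_mul, abs_of_pos (inv_pos.2 ht0), inv_mul_le_iff₀ ht0]
      exact key
    have b2 : G * (η * C) ≤ G * ((2 * C + 1) * η) := by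
      refine mul_le_mul_of_nonneg_left ?_ hG
      nlinarith
    have k1 := abs_le.1 key2
    have k2 := abs_le.1 b
    exact abs_lt.2 ⟨by linarith, by linarith⟩

end IsTestPair

/-! ### Exponent, weight, modular and energy -/

/-- Standing assumptions on the exponent `p`, with bounds `a > 1` and `b`, and the weight `ϑ`. -/
structure IsExponentWeight {d : ℕ} (p ϑ : EuclideanSpace ℝ (Fin d) → ℝ) (a b : ℝ) : Prop where
  measurable_exponent : Measurable p
  one_lt : 1 < a
  le_exponent : ∀ y, a ≤ p y
  exponent_le : ∀ y, p y ≤ b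
  measurable_weight : Measurable ϑ
  weight_pos : ∀ y, 0 < ϑ y
  locallyIntegrable_weight : LocallyIntegrable ϑ volume
  locallyIntegrable_dual : LocallyIntegrable (fun y => ϑ y ^ (-(1 / (p y - 1)))) volume

/-- The Dirichlet energy of the gradient `g` over the whole space. -/
noncomputable def energy {d : ℕ} (p ϑ : EuclideanSpace ℝ (Fin d) → ℝ)
    (g : EuclideanSpace ℝ (Fin d) → EuclideanSpace ℝ (Fin d)) : ℝ≥0∞ :=
  modular p ϑ univ fun y => ‖g y‖

variable {p ϑ : EuclideanSpace ℝ (Fin d) → ℝ} {a b : ℝ}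

namespace IsExponentWeight

theorem one_lt_exponent (W : IsExponentWeight p ϑ a b) (y : EuclideanSpace ℝ (Fin d)) : 1 < p y :=
  W.one_lt.trans_le (W.le_exponent y)

theorem exponent_pos (W : IsExponentWeight p ϑ a b) (y : EuclideanSpace ℝ (Fin d)) : 0 < p y :=
  one_pos.trans (W.one_lt_exponent y)

theorem modular_div_le (W : IsExponentWeight p ϑ a b) (f : EuclideanSpace ℝ (Fin d) → ℝ)
    (Ω : Set (EuclideanSpace ℝ (Fin d))) {l : ℝ} (hl : 1 ≤ l) :
    modular p ϑ Ω (fun y => f y / l) ≤ ENNReal.ofReal (1 / l) * modular p ϑ Ω f := by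
  have hl0 : 0 < l := one_pos.trans_le hl
  unfold modular
  rw [← lintegral_const_mul' _ _ ENNReal.ofReal_ne_top]
  refine lintegral_mono fun y => ?_
  rw [← ENNReal.ofReal_mul (by positivity)]
  refine ENNReal.ofReal_le_ofReal ?_
  rw [abs_div, abs_of_pos hl0, Real.div_rpow (abs_nonneg _) hl0.le, ← mul_assoc]
  refine mul_le_mul_of_nonneg_right ?_ (W.weight_pos y).le
  rw [div_eq_inv_mul, one_div]
  gcongr
  simpa using Real.rpow_le_rpow_of_exponent_le hl (W.one_lt_exponent y).le

theorem memLpVar_of_modular_lt_top (W : IsExponentWeight p ϑ a b)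
    {f : EuclideanSpace ℝ (Fin d) → ℝ} (hf : AEMeasurable f) (h : modular p ϑ univ f < ∞)
    (Ω : Set (EuclideanSpace ℝ (Fin d))) : MemLpVar p ϑ Ω f := by
  have hΩ : modular p ϑ Ω f < ∞ := (lintegral_mono_set (subset_univ Ω)).trans_lt h
  refine ⟨hf.restrict, max 1 (modular p ϑ Ω f).toReal, by positivity, ?_⟩
  refine (W.modular_div_le f Ω (le_max_left _ _)).trans ?_
  rw [← ENNReal.ofReal_toReal hΩ.ne, ← ENNReal.ofReal_mul (by positivity),
    ENNReal.toReal_ofReal ENNReal.toReal_nonneg, ← ENNReal.ofReal_one]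
  refine ENNReal.ofReal_le_ofReal ?_
  rw [one_div, inv_mul_le_iff₀ (by positivity), mul_one]
  exact le_max_right _ _

theorem lintegral_weight_lt_top (W : IsExponentWeight p ϑ a b)
    {S : Set (EuclideanSpace ℝ (Fin d))} (hS : IsCompact S) :
    ∫⁻ y in S, ENNReal.ofReal (ϑ y) < ∞ :=
  (W.locallyIntegrable_weight.integrableOn_isCompact hS).lintegral_lt_top

theorem modular_lt_top_of_bounded (W : IsExponentWeight p ϑ a b)
    {S : Set (EuclideanSpace ℝ (Fin d))} (hS : IsCompact S)
    {f : EuclideanSpace ℝ (Fin d) → ℝ} (hf : ∀ y ∉ S, f y = 0) {M : ℝ} (hM : ∀ y, |f y| ≤ M) :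
    modular p ϑ univ f < ∞ := by
  have h1 : ∀ y, ENNReal.ofReal (|f y| ^ p y * ϑ y) ≤
      S.indicator (fun y => ENNReal.ofReal (max 1 M ^ b) * ENNReal.ofReal (ϑ y)) y := fun y => by
    by_cases hy : y ∈ S
    · rw [indicator_of_mem hy, ← ENNReal.ofReal_mul (by positivity)]
      refine ENNReal.ofReal_le_ofReal (mul_le_mul_of_nonneg_right ?_ (W.weight_pos y).le)
      calc |f y| ^ p y ≤ max 1 M ^ p y :=
            Real.rpow_le_rpow (abs_nonneg _) ((hM y).trans (le_max_right _ _)) (W.exponent_pos y).le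
        _ ≤ max 1 M ^ b :=
            Real.rpow_le_rpow_of_exponent_le (le_max_left _ _) (W.exponent_le y)
    · simp [hf y hy, Real.zero_rpow (W.exponent_pos y).ne']
  unfold modular
  rw [Measure.restrict_univ]
  refine (lintegral_mono h1).trans_lt ?_
  rw [lintegral_indicator hS.measurableSet, lintegral_const_mul' _ _ ENNReal.ofReal_ne_top]
  exact ENNReal.mul_lt_top ENNReal.ofReal_lt_top (W.lintegral_weight_lt_top hS)

end IsExponentWeight

theorem modular_le_energy (Ω : Set (EuclideanSpace ℝ (Fin d)))
    (g : EuclideanSpace ℝ (Fin d) → EuclideanSpace ℝ (Fin d)) :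
    modular p ϑ Ω (fun y => ‖g y‖) ≤ energy p ϑ g :=
  lintegral_mono_set (subset_univ Ω)

theorem energy_indicator_le (W : IsExponentWeight p ϑ a b)
    {S Ω : Set (EuclideanSpace ℝ (Fin d))} (hS : MeasurableSet S) (hSΩ : S ⊆ Ω)
    (g : EuclideanSpace ℝ (Fin d) → EuclideanSpace ℝ (Fin d)) :
    energy p ϑ (S.indicator g) ≤ modular p ϑ Ω fun y => ‖g y‖ := by
  have h1 : ∀ y, ENNReal.ofReal (|‖S.indicator g y‖| ^ p y * ϑ y) =
      S.indicator (fun y => ENNReal.ofReal (|‖g y‖| ^ p y * ϑ y)) y := fun y => by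
    by_cases hy : y ∈ S
    · simp [hy]
    · simp [hy, Real.zero_rpow (W.exponent_pos y).ne']
  unfold energy modular
  rw [Measure.restrict_univ, lintegral_congr h1, lintegral_indicator hS]
  exact lintegral_mono_set hSΩ

/-! ### Capacity in terms of test pairs -/

namespace IsTestPair

variable {S K Ω : Set (EuclideanSpace ℝ (Fin d))}
  {f : EuclideanSpace ℝ (Fin d) → ℝ} {g : EuclideanSpace ℝ (Fin d) → EuclideanSpace ℝ (Fin d)}

theorem admissible (W : IsExponentWeight p ϑ a b) (h : IsTestPair S f g) (hSΩ : S ⊆ Ω)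
    (hK : ∀ y ∈ K, 1 < f y) (h0 : ∀ y, 0 ≤ f y) (hE : energy p ϑ g < ∞) :
    Admissible p ϑ K Ω f g := by
  obtain ⟨M, hM⟩ := h.continuous.bounded_above_of_compact_support h.hasCompactSupport
  refine ⟨⟨⟨h.integrable.locallyIntegrable.locallyIntegrableOn Ω,
    h.integrable_grad.locallyIntegrable.locallyIntegrableOn Ω, fun φ hφ hc _ v => ?_⟩, ?_, ?_⟩,
    h.continuous, h.hasCompactSupport, h.tsupport_subset.trans hSΩ, hK, h0⟩
  · rw [setIntegral_eq_integral_of_forall_compl_eq_zero fun y hy => by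
        rw [h.fun_eq_zero y fun hyS => hy (hSΩ hyS), zero_mul],
      setIntegral_eq_integral_of_forall_compl_eq_zero fun y hy => by
        rw [h.grad_eq_zero y fun hyS => hy (hSΩ hyS), inner_zero_left, zero_mul]]
    exact h.weak φ hφ hc v
  · exact W.memLpVar_of_modular_lt_top h.continuous.aemeasurable
      (W.modular_lt_top_of_bounded h.isCompact h.fun_eq_zero hM) Ω
  · exact W.memLpVar_of_modular_lt_top h.integrable_grad.norm.aestronglyMeasurable.aemeasurable hE Ω

theorem capCompact_le (W : IsExponentWeight p ϑ a b) (h : IsTestPair S f g) (hSΩ : S ⊆ Ω)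
    (hK : ∀ y ∈ K, 1 < f y) (h0 : ∀ y, 0 ≤ f y) : capCompact p ϑ K Ω ≤ energy p ϑ g := by
  by_cases hE : energy p ϑ g = ∞
  · exact hE ▸ le_top
  · exact (iInf₂_le_of_le f g (iInf_le _ (h.admissible W hSΩ hK h0 (lt_top_iff_ne_top.2 hE)))).trans
      (modular_le_energy Ω g)

end IsTestPair

/-- Test functions supported off `tsupport f` see `f = 0`, so `g` integrates to zero against all of
them. -/
theorem IsWeakGradient.ae_eq_zero {Ω : Set (EuclideanSpace ℝ (Fin d))} (hΩ : IsOpen Ω)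
    {f : EuclideanSpace ℝ (Fin d) → ℝ} {g : EuclideanSpace ℝ (Fin d) → EuclideanSpace ℝ (Fin d)}
    (h : IsWeakGradient Ω f g) : ∀ᵐ y, y ∈ Ω \ tsupport f → g y = 0 := by
  have hU : IsOpen (Ω \ tsupport f) := hΩ.sdiff (isClosed_tsupport f)
  refine hU.ae_eq_zero_of_integral_contDiff_smul_eq_zero (h.2.1.mono_set sdiff_subset)
    fun φ hφ hc hs => ?_
  have hΩφ : ∀ y ∉ Ω, φ y = 0 := fun y hy =>
    image_eq_zero_of_notMem_tsupport fun hyt => hy (hs hyt).1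
  refine ext_inner_right ℝ fun v => ?_
  have hint : Integrable fun y => φ y • g y := by
    have h1 : IntegrableOn g (tsupport φ) :=
      h.2.1.integrableOn_compact_subset (hs.trans sdiff_subset) hc
    have h2 : IntegrableOn (fun y => φ y • g y) (tsupport φ) := by
      obtain ⟨C, hC⟩ := hφ.continuous.bounded_above_of_compact_support hc
      exact Integrable.bdd_smul (C := C) h1 hφ.continuous.aestronglyMeasurable (ae_of_all _ hC)
    refine (integrableOn_iff_integrable_of_support_subset fun y hy => ?_).1 h2
    exact subset_tsupport φ fun hφy => hy (by simp [hφy])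
  have key := h.2.2 φ hφ hc (hs.trans sdiff_subset) v
  have z : ∀ y, f y * fderiv ℝ φ y v = 0 := fun y => by
    by_cases hy : y ∈ tsupport f
    · have : fderiv ℝ φ y = 0 := by
        by_contra hne
        exact (hs (support_fderiv_subset ℝ hne)).2 hy
      simp [this]
    · simp [image_eq_zero_of_notMem_tsupport hy]
  simp only [z, integral_zero] at key
  rw [setIntegral_eq_integral_of_forall_compl_eq_zero fun y hy => by rw [hΩφ y hy, mul_zero]] at key
  rw [inner_zero_left, real_inner_comm, ← integral_inner hint]
  simp_rw [real_inner_smul_right]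
  rw [← neg_eq_zero, key]
  congr 1
  exact integral_congr_ae (ae_of_all _ fun y => by simp only [real_inner_comm v, mul_comm])

theorem Admissible.isTestPair {K Ω : Set (EuclideanSpace ℝ (Fin d))} (hΩ : IsOpen Ω)
    {f : EuclideanSpace ℝ (Fin d) → ℝ} {g : EuclideanSpace ℝ (Fin d) → EuclideanSpace ℝ (Fin d)}
    (h : Admissible p ϑ K Ω f g) :
    IsTestPair (tsupport f) f ((tsupport f).indicator g) := by
  obtain ⟨⟨hw, -, -⟩, hf, hfc, hfΩ, -, -⟩ := h
  refine ⟨hfc, hf, fun y hy => image_eq_zero_of_notMem_tsupport hy,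
    fun y hy => indicator_of_notMem hy g, ?_, fun φ hφ hc v => ?_⟩
  · rw [integrable_indicator_iff (isClosed_tsupport f).measurableSet]
    exact hw.2.1.integrableOn_compact_subset hfΩ hfc
  -- An arbitrary `φ` need not be supported in `Ω`; multiplying it by a cutoff equal to `1` near
  -- `tsupport f` makes it so without changing either integral.
  obtain ⟨χ, hχ, hχc, hχΩ, hχ1, -⟩ := exists_smooth_cutoff (K := tsupport f) hfc hΩ hfΩ
  have key := hw.2.2 (fun y => χ y * φ y) (hχ.mul hφ) hχc.mul_right
    ((tsupport_mul_subset_left).trans hχΩ) v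
  rw [setIntegral_eq_integral_of_forall_compl_eq_zero fun y hy => by
    rw [image_eq_zero_of_notMem_tsupport fun hyt => hy (hfΩ hyt), zero_mul]] at key
  have e1 : ∀ y, f y * fderiv ℝ (fun y => χ y * φ y) y v = f y * fderiv ℝ φ y v := fun y => by
    by_cases hy : y ∈ tsupport f
    · have : (fun y => χ y * φ y) =ᶠ[𝓝 y] φ := by
        filter_upwards [(eventually_nhdsSet_iff_forall.1 hχ1) y hy] with z hz
        rw [hz, one_mul]
      rw [this.fderiv_eq]
    · simp [image_eq_zero_of_notMem_tsupport hy]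
  have e2 : ∀ᵐ y, y ∈ Ω → ⟪g y, v⟫_ℝ * (χ y * φ y)
      = ⟪(tsupport f).indicator g y, v⟫_ℝ * φ y := by
    filter_upwards [hw.ae_eq_zero hΩ] with y hy hyΩ
    by_cases hyf : y ∈ tsupport f
    · have : χ y = 1 := ((eventually_nhdsSet_iff_forall.1 hχ1) y hyf).self_of_nhds
      rw [indicator_of_mem hyf, this, one_mul]
    · rw [indicator_of_notMem hyf, hy ⟨hyΩ, hyf⟩]
      simp
  simp_rw [e1] at key
  rw [key, setIntegral_congr_ae hΩ.measurableSet e2,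
    setIntegral_eq_integral_of_forall_compl_eq_zero fun y hy => by
      rw [indicator_of_notMem fun hyf => hy (hfΩ hyf), inner_zero_left, zero_mul]]

/-- Competitors for `capCompact` may be taken bounded by `2`, in terms of test pairs. -/
theorem exists_isTestPair_of_capCompact_lt (W : IsExponentWeight p ϑ a b)
    {K Ω : Set (EuclideanSpace ℝ (Fin d))} (hΩ : IsOpen Ω) {t : ℝ≥0∞}
    (ht : capCompact p ϑ K Ω < t) :
    ∃ S f g, IsTestPair S f g ∧ S ⊆ Ω ∧ (∀ y ∈ K, 1 < f y) ∧ (∀ y, 0 ≤ f y) ∧ (∀ y, f y ≤ 2) ∧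
      energy p ϑ g < t := by
  simp only [capCompact, iInf_lt_iff] at ht
  obtain ⟨f, g, h, hlt⟩ := ht
  -- Truncation keeps `f > 1` on `K`, and its derivative lies in `[0, 1]`, so the energy does not
  -- grow.
  refine ⟨_, _, _, (h.isTestPair hΩ).truncate, h.2.2.2.1, fun y hy => one_lt_truncate (h.2.2.2.2.1 y hy),
    fun y => truncate_nonneg (h.2.2.2.2.2 y), fun y => truncate_le_two, lt_of_le_of_lt ?_ hlt⟩
  refine le_trans ?_ (energy_indicator_le W (isClosed_tsupport f).measurableSet h.2.2.2.1 g)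
  refine lintegral_mono fun y => ENNReal.ofReal_le_ofReal ?_
  refine mul_le_mul_of_nonneg_right ?_ (W.weight_pos y).le
  rw [abs_norm, abs_norm]
  refine Real.rpow_le_rpow (norm_nonneg _) ?_ (W.exponent_pos y).le
  rw [norm_smul, Real.norm_eq_abs, abs_of_nonneg (truncateDeriv_nonneg _)]
  exact mul_le_of_le_one_left (norm_nonneg _) (truncateDeriv_le_one _)

/-- The gradient of a test pair is global, so a competitor supported in `Ω` also competes in `Ω'`.
-/
theorem capCompact_anti (W : IsExponentWeight p ϑ a b)
    {K Ω Ω' : Set (EuclideanSpace ℝ (Fin d))} (hΩ : IsOpen Ω) (h : Ω ⊆ Ω') :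
    capCompact p ϑ K Ω' ≤ capCompact p ϑ K Ω := by
  refine le_of_forall_gt fun t ht => ?_
  obtain ⟨S, f, g, hfg, hS, hK, h0, -, hE⟩ := exists_isTestPair_of_capCompact_lt W hΩ ht
  exact (hfg.capCompact_le W (hS.trans h) hK h0).trans_lt hE

theorem capOpen_mono (W : IsExponentWeight p ϑ a b)
    {U U' Ω Ω' : Set (EuclideanSpace ℝ (Fin d))} (hΩ : IsOpen Ω) (hU : U ⊆ U') (h : Ω ⊆ Ω') :
    capOpen p ϑ U Ω' ≤ capOpen p ϑ U' Ω :=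
  iSup₂_le fun K hK => iSup_le fun hKU =>
    (capCompact_anti W hΩ h).trans (le_iSup₂_of_le K hK (le_iSup_of_le (hKU.trans hU) le_rfl))

/-! ### Uniform convexity and elementary inequalities -/

/-- If the norms agree, strict convexity of the norm ball applies; if they differ, strict convexity
of `t ^ q` does. -/
theorem norm_midpoint_rpow_lt {E : Type*} [NormedAddCommGroup E] [InnerProductSpace ℝ E] {q : ℝ}
    (hq : 1 < q) {u v : E} (huv : u ≠ v) :
    ‖(1 / 2 : ℝ) • u + (1 / 2 : ℝ) • v‖ ^ q < (‖u‖ ^ q + ‖v‖ ^ q) / 2 := by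
  have hq0 : 0 < q := one_pos.trans hq
  rcases eq_or_ne ‖u‖ ‖v‖ with h | h
  · have := norm_combo_lt_of_ne (le_refl ‖u‖) h.ge huv (a := (1 / 2 : ℝ)) (b := 1 / 2)
      (by norm_num) (by norm_num) (by norm_num)
    rw [← h, add_self_div_two]
    exact Real.rpow_lt_rpow (norm_nonneg _) this hq0
  · have h1 := (strictConvexOn_rpow hq).2 (mem_Ici.2 (norm_nonneg u)) (mem_Ici.2 (norm_nonneg v)) h
      (show (0 : ℝ) < 1 / 2 by norm_num) (show (0 : ℝ) < 1 / 2 by norm_num) (by norm_num)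
    have h2 : ‖(1 / 2 : ℝ) • u + (1 / 2 : ℝ) • v‖ ≤ (1 / 2 : ℝ) • ‖u‖ + (1 / 2 : ℝ) • ‖v‖ := by
      refine (norm_add_le _ _).trans (le_of_eq ?_)
      simp [norm_smul]
    refine (Real.rpow_le_rpow (norm_nonneg _) h2 hq0.le).trans_lt (h1.trans_le (le_of_eq ?_))
    simp only [smul_eq_mul]; ring

theorem norm_midpoint_rpow_le {E : Type*} [NormedAddCommGroup E] [InnerProductSpace ℝ E] {q : ℝ}
    (hq : 1 < q) (u v : E) :
    ‖(1 / 2 : ℝ) • u + (1 / 2 : ℝ) • v‖ ^ q ≤ (‖u‖ ^ q + ‖v‖ ^ q) / 2 := by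
  rcases eq_or_ne u v with rfl | h
  · rw [← add_smul, add_halves, one_smul, add_self_div_two]
  · exact (norm_midpoint_rpow_lt hq h).le

/-- Uniform convexity of `‖·‖ ^ q`, uniformly in `q ∈ [a, b]`, `a > 1`. -/
theorem exists_uniform_convexity_const (E : Type*) [NormedAddCommGroup E] [InnerProductSpace ℝ E]
    [FiniteDimensional ℝ E] {a : ℝ} (ha : 1 < a) (b : ℝ) {κ : ℝ} (hκ : 0 < κ) :
    ∃ C : ℝ, 0 ≤ C ∧ ∀ q ∈ Icc a b, ∀ u v : E,
      ‖u - v‖ ^ q + C * ‖(1 / 2 : ℝ) • u + (1 / 2 : ℝ) • v‖ ^ q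
        ≤ (κ + C / 2) * (‖u‖ ^ q + ‖v‖ ^ q) := by
  let X := ℝ × E × E
  -- The exponent `max a z.1` equals `q` for `q ≥ a` and stays positive elsewhere, which gives
  -- continuity on all of `X`.
  have hexp : Continuous fun z : X => max a z.1 := continuous_const.max continuous_fst
  have hpos : ∀ z : X, 0 < max a z.1 := fun z => lt_max_of_lt_left (one_pos.trans ha)
  have hc : ∀ w : X → E, Continuous w → Continuous fun z : X => ‖w z‖ ^ (max a z.1) := fun w hw =>
    hw.norm.rpow hexp fun z => Or.inr (hpos z)
  have hu : Continuous fun z : X => z.2.1 := continuous_snd.fst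
  have hv : Continuous fun z : X => z.2.2 := continuous_snd.snd
  let D : X → ℝ := fun z => (‖z.2.1‖ ^ (max a z.1) + ‖z.2.2‖ ^ (max a z.1)) / 2
    - ‖(1 / 2 : ℝ) • z.2.1 + (1 / 2 : ℝ) • z.2.2‖ ^ (max a z.1)
  have hD : Continuous D := (((hc _ hu).add (hc _ hv)).div_const 2).sub
    (hc _ ((hu.const_smul _).add (hv.const_smul _)))
  -- On this compact set of separated pairs the convexity defect `D` has a positive lower bound `δ`.
  -- There `‖u - v‖ ^ q ≤ 2 ^ b`, whence the constant `2 ^ b / δ`; for pairs that are not separated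
  -- the `κ` term suffices.
  let Z : Set X := (Icc a b ×ˢ (Metric.closedBall 0 1 ×ˢ Metric.closedBall 0 1)) ∩
    {z | κ ≤ ‖z.2.1 - z.2.2‖ ^ (max a z.1)}
  have hZ : IsCompact Z :=
    (isCompact_Icc.prod ((isCompact_closedBall 0 1).prod (isCompact_closedBall 0 1))).inter_right
      (isClosed_le continuous_const (hc _ (hu.sub hv)))
  obtain ⟨δ, hδ, hδD⟩ := hZ.exists_forall_le' hD.continuousOn (a := 0) fun z hz => by
    refine sub_pos.2 (norm_midpoint_rpow_lt (lt_max_of_lt_left ha) fun h => ?_)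
    have h2 : κ ≤ ‖z.2.1 - z.2.2‖ ^ (max a z.1) := hz.2
    rw [h, sub_self, norm_zero, Real.zero_rpow (hpos z).ne'] at h2
    linarith
  have main : ∀ q ∈ Icc a b, ∀ u v : E, ‖u‖ ≤ 1 → ‖v‖ ≤ 1 → 1 ≤ ‖u‖ ^ q + ‖v‖ ^ q →
      ‖u - v‖ ^ q + 2 ^ b / δ * ‖(1 / 2 : ℝ) • u + (1 / 2 : ℝ) • v‖ ^ q
        ≤ (κ + 2 ^ b / δ / 2) * (‖u‖ ^ q + ‖v‖ ^ q) := by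
    intro q hq u v hu hv h1
    have hq1 : 1 < q := ha.trans_le hq.1
    have hD0 := norm_midpoint_rpow_le hq1 u v
    have hC0 : (0 : ℝ) ≤ 2 ^ b / δ := by positivity
    by_cases hκ' : κ ≤ ‖u - v‖ ^ q
    · have hmem : ((q, u, v) : X) ∈ Z := by
        refine ⟨⟨hq, by simpa using hu, by simpa using hv⟩, ?_⟩
        simpa [max_eq_right hq.1] using hκ'
      have hd := hδD _ hmem
      simp only [D, max_eq_right hq.1] at hd
      have h2 : ‖u - v‖ ^ q ≤ 2 ^ b := by
        calc ‖u - v‖ ^ q ≤ 2 ^ q := Real.rpow_le_rpow (norm_nonneg _)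
              ((norm_sub_le u v).trans (by linarith)) (by linarith)
          _ ≤ 2 ^ b := Real.rpow_le_rpow_of_exponent_le one_le_two hq.2
      have h3 := mul_le_mul_of_nonneg_left hd hC0
      rw [div_mul_cancel₀ _ hδ.ne'] at h3
      have h4 : 0 ≤ κ * (‖u‖ ^ q + ‖v‖ ^ q) := by positivity
      nlinarith
    · have h3 := mul_le_mul_of_nonneg_left hD0 hC0
      have h4 : κ ≤ κ * (‖u‖ ^ q + ‖v‖ ^ q) := le_mul_of_one_le_right hκ.le h1
      push Not at hκ'
      nlinarith
  refine ⟨2 ^ b / δ, by positivity, fun q hq u v => ?_⟩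
  have hq0 : 0 < q := one_pos.trans (ha.trans_le hq.1)
  -- Both sides are homogeneous of degree `q`, so dividing by the larger norm reduces to `main`.
  set m := max ‖u‖ ‖v‖ with hm
  have hm0 : 0 ≤ m := (norm_nonneg u).trans (le_max_left _ _)
  rcases hm0.eq_or_lt with h0 | h0
  · have hu0 : u = 0 := norm_le_zero_iff.1 (h0 ▸ le_max_left ‖u‖ ‖v‖)
    have hv0 : v = 0 := norm_le_zero_iff.1 (h0 ▸ le_max_right ‖u‖ ‖v‖)
    simp [hu0, hv0, Real.zero_rpow hq0.ne']
  · have hs : ∀ w : E, ‖m⁻¹ • w‖ ^ q = ‖w‖ ^ q / m ^ q := fun w => by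
      rw [norm_smul, norm_inv, Real.norm_eq_abs, abs_of_pos h0, ← div_eq_inv_mul,
        Real.div_rpow (norm_nonneg _) hm0]
    have hn : ∀ w : E, ‖w‖ ≤ m → ‖m⁻¹ • w‖ ≤ 1 := fun w hw => by
      rw [norm_smul, norm_inv, Real.norm_eq_abs, abs_of_pos h0, inv_mul_le_iff₀ h0, mul_one]
      exact hw
    have hmq : 0 < m ^ q := Real.rpow_pos_of_pos h0 q
    have key := main q hq (m⁻¹ • u) (m⁻¹ • v) (hn u (le_max_left _ _)) (hn v (le_max_right _ _)) (by
      rw [hs, hs, ← add_div, le_div_iff₀ hmq, one_mul]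
      rcases max_choice ‖u‖ ‖v‖ with h | h <;> rw [hm, h]
      · exact le_add_of_nonneg_right (by positivity)
      · exact le_add_of_nonneg_left (by positivity))
    rw [← smul_sub, smul_comm _ m⁻¹, smul_comm _ m⁻¹, ← smul_add, hs, hs, hs, hs, ← add_div,
      ← mul_div_assoc, ← mul_div_assoc, ← add_div, div_le_div_iff_of_pos_right hmq] at key
    exact key

/-- If `y ≤ θ * x`, a small `θ` makes `(1 + θ) ^ b < Λ`; otherwise `x` is dominated by `θ⁻¹ * y`. -/
theorem exists_add_rpow_le {b Λ : ℝ} (hb : 0 ≤ b) (hΛ : 1 < Λ) :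
    ∃ C : ℝ, 0 ≤ C ∧ ∀ q ∈ Icc 0 b, ∀ x y : ℝ, 0 ≤ x → 0 ≤ y →
      (x + y) ^ q ≤ Λ * x ^ q + C * y ^ q := by
  have hcont : ContinuousAt (fun θ : ℝ => (1 + θ) ^ b) 0 :=
    (continuousAt_const.add continuousAt_id).rpow_const (Or.inr hb)
  have hlim : ∀ᶠ θ in 𝓝[>] (0 : ℝ), (1 + θ) ^ b < Λ :=
    (hcont.eventually_lt continuousAt_const (by simpa using hΛ)).filter_mono nhdsWithin_le_nhds
  obtain ⟨θ, hθ, hθ0 : 0 < θ⟩ := (hlim.and eventually_mem_nhdsWithin).exists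
  refine ⟨(1 + θ⁻¹) ^ b, by positivity, fun q hq x y hx hy => ?_⟩
  have hx' : 0 ≤ x ^ q := by positivity
  have hy' : 0 ≤ y ^ q := by positivity
  have bound : ∀ c : ℝ, 1 ≤ c → ∀ z : ℝ, 0 ≤ z → (c * z) ^ q ≤ c ^ b * z ^ q := fun c hc z hz => by
    rw [Real.mul_rpow (by linarith) hz]
    gcongr
    exact hq.2
  rcases le_total y (θ * x) with h | h
  · have h1 : (x + y) ^ q ≤ ((1 + θ) * x) ^ q :=
      Real.rpow_le_rpow (by positivity) (by linarith) hq.1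
    have h2 := bound (1 + θ) (by linarith) x hx
    have h3 : (1 + θ) ^ b * x ^ q ≤ Λ * x ^ q := by gcongr
    have h4 : 0 ≤ (1 + θ⁻¹) ^ b * y ^ q := by positivity
    linarith
  · have h0 : x ≤ θ⁻¹ * y := by rwa [← div_eq_inv_mul, le_div_iff₀ hθ0, mul_comm]
    have h1 : (x + y) ^ q ≤ ((1 + θ⁻¹) * y) ^ q :=
      Real.rpow_le_rpow (by positivity) (by linarith) hq.1
    have h2 := bound (1 + θ⁻¹) (by linarith [inv_pos.2 hθ0]) y hy
    have h4 : 0 ≤ Λ * x ^ q := by positivity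
    linarith

/-- A Young-type inequality: when `t` exceeds the first term, `t ^ (q - 1) * w ≥ l ^ (q - 1)`, and
`l ≤ 1` allows `q` to be replaced by `b`. It lets the integrable dual weight turn small energy into
a small `L¹` norm. -/
theorem le_dual_add_rpow_mul {q b l w t : ℝ} (hq : 1 < q) (hqb : q ≤ b) (hl : 0 < l) (hl1 : l ≤ 1)
    (hw : 0 < w) (ht : 0 ≤ t) :
    t ≤ l * w ^ (-(1 / (q - 1))) + l ^ (1 - b) * (t ^ q * w) := by
  have hq1 : 0 < q - 1 := sub_pos.2 hq
  rcases le_or_gt t (l * w ^ (-(1 / (q - 1)))) with h | h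
  · exact h.trans (le_add_of_nonneg_right (by positivity))
  · have hz : 0 < l * w ^ (-(1 / (q - 1))) := by positivity
    have ht0 : 0 < t := hz.trans h
    have h1 : l ^ (q - 1) * w⁻¹ ≤ t ^ (q - 1) := by
      have := Real.rpow_le_rpow hz.le h.le hq1.le
      rwa [Real.mul_rpow hl.le (by positivity), ← Real.rpow_mul hw.le, neg_mul,
        one_div_mul_cancel hq1.ne', Real.rpow_neg_one] at this
    have h2 : l ^ (q - 1) ≤ t ^ (q - 1) * w := by
      rwa [← div_eq_mul_inv, div_le_iff₀ hw] at h1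
    have h3 : t ^ q = t * t ^ (q - 1) := by
      rw [← Real.rpow_one_add' ht (by linarith)]; congr 1; ring
    have h4 : 1 ≤ l ^ (1 - b) * l ^ (q - 1) := by
      rw [← Real.rpow_add hl]
      exact Real.one_le_rpow_of_pos_of_le_one_of_nonpos hl hl1 (by linarith)
    have h5 : t ≤ l ^ (1 - b) * (t ^ q * w) := by
      calc t ≤ t * (l ^ (1 - b) * l ^ (q - 1)) := le_mul_of_one_le_right ht h4
        _ ≤ t * (l ^ (1 - b) * (t ^ (q - 1) * w)) := by gcongr
        _ = l ^ (1 - b) * (t ^ q * w) := by rw [h3]; ring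
    linarith

/-! ### Integral estimates for the energy -/

theorem modular_univ (f : EuclideanSpace ℝ (Fin d) → ℝ) :
    modular p ϑ univ f = ∫⁻ y, ENNReal.ofReal (|f y| ^ p y * ϑ y) := by
  rw [modular, Measure.restrict_univ]

theorem energy_eq (g : EuclideanSpace ℝ (Fin d) → EuclideanSpace ℝ (Fin d)) :
    energy p ϑ g = ∫⁻ y, ENNReal.ofReal (‖g y‖ ^ p y * ϑ y) := by
  simp [energy, modular_univ]

theorem IsExponentWeight.aemeasurable_integrand (W : IsExponentWeight p ϑ a b)
    {f : EuclideanSpace ℝ (Fin d) → ℝ} (hf : AEMeasurable f) :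
    AEMeasurable fun y => ENNReal.ofReal (f y ^ p y * ϑ y) :=
  ((hf.pow W.measurable_exponent.aemeasurable).mul
    W.measurable_weight.aemeasurable).ennreal_ofReal

/-- Integrated uniform convexity of the energy. -/
theorem IsExponentWeight.exists_energy_sub_le (W : IsExponentWeight p ϑ a b) {κ : ℝ} (hκ : 0 < κ) :
    ∃ C : ℝ, 0 ≤ C ∧ ∀ g₁ g₂ : EuclideanSpace ℝ (Fin d) → EuclideanSpace ℝ (Fin d),
      AEStronglyMeasurable g₁ volume → AEStronglyMeasurable g₂ volume →
      energy p ϑ (fun y => g₁ y - g₂ y) + ENNReal.ofReal C *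
          energy p ϑ (fun y => (1 / 2 : ℝ) • g₁ y + (1 / 2 : ℝ) • g₂ y)
        ≤ ENNReal.ofReal (κ + C / 2) * (energy p ϑ g₁ + energy p ϑ g₂) := by
  obtain ⟨C, hC, h⟩ := exists_uniform_convexity_const (EuclideanSpace ℝ (Fin d)) W.one_lt b hκ
  refine ⟨C, hC, fun g₁ g₂ h₁ h₂ => ?_⟩
  simp only [energy_eq]
  have hm : AEMeasurable fun y => ENNReal.ofReal (‖g₁ y - g₂ y‖ ^ p y * ϑ y) :=
    W.aemeasurable_integrand (h₁.sub h₂).norm.aemeasurable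
  rw [← lintegral_const_mul' _ _ ENNReal.ofReal_ne_top,
    ← lintegral_add_left' hm,
    ← lintegral_add_left' (W.aemeasurable_integrand h₁.norm.aemeasurable),
    ← lintegral_const_mul' _ _ ENNReal.ofReal_ne_top]
  refine lintegral_mono fun y => ?_
  have hw := (W.weight_pos y).le
  dsimp only
  rw [← ENNReal.ofReal_mul hC, ← ENNReal.ofReal_add (by positivity) (by positivity),
    ← ENNReal.ofReal_add (by positivity) (by positivity), ← ENNReal.ofReal_mul (by positivity)]
  refine ENNReal.ofReal_le_ofReal ?_
  have := mul_le_mul_of_nonneg_right (h (p y) ⟨W.le_exponent y, W.exponent_le y⟩ (g₁ y) (g₂ y)) hw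
  nlinarith

/-- The energy controls the `L¹` norm of gradients supported in a fixed compact set. -/
theorem IsExponentWeight.exists_integral_norm_le (W : IsExponentWeight p ϑ a b)
    {B : Set (EuclideanSpace ℝ (Fin d))} (hB : IsCompact B) {ε : ℝ} (hε : 0 < ε) :
    ∃ δ : ℝ, 0 < δ ∧ ∀ g : EuclideanSpace ℝ (Fin d) → EuclideanSpace ℝ (Fin d),
      Integrable g → (∀ y ∉ B, g y = 0) → energy p ϑ g ≤ ENNReal.ofReal δ →
        ∫ y, ‖g y‖ ≤ ε := by
  set J := ∫ y in B, ϑ y ^ (-(1 / (p y - 1)))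
  have hJ : 0 ≤ J := integral_nonneg fun y => Real.rpow_nonneg (W.weight_pos y).le _
  -- `l` makes the dual-weight term at most `ε / 2`; the energy then carries the factor `D`, hence
  -- `δ = ε / 2 / D`.
  obtain ⟨l, hl0, hl1, hlJ⟩ : ∃ l : ℝ, 0 < l ∧ l ≤ 1 ∧ l * J ≤ ε / 2 := by
    refine ⟨min 1 (ε / 2 / (J + 1)), by positivity, min_le_left _ _, ?_⟩
    calc min 1 (ε / 2 / (J + 1)) * J ≤ ε / 2 / (J + 1) * (J + 1) := by
          gcongr
          · exact min_le_right _ _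
          · linarith
      _ = ε / 2 := div_mul_cancel₀ _ (by positivity)
  set D := l ^ (1 - b)
  have hD : 0 < D := Real.rpow_pos_of_pos hl0 _
  refine ⟨ε / 2 / D, by positivity, fun g hg hgB hE => ?_⟩
  have hJ' : ∫⁻ y in B, ENNReal.ofReal (l * ϑ y ^ (-(1 / (p y - 1)))) = ENNReal.ofReal (l * J) := by
    rw [← integral_const_mul, ofReal_integral_eq_lintegral_ofReal]
    · exact (W.locallyIntegrable_dual.integrableOn_isCompact hB).const_mul l
    · exact ae_of_all _ fun y => mul_nonneg hl0.le (Real.rpow_nonneg (W.weight_pos y).le _)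
  have h1 : ENNReal.ofReal (∫ y, ‖g y‖) ≤ ENNReal.ofReal ε := by
    rw [ofReal_integral_eq_lintegral_ofReal hg.norm (ae_of_all _ fun y => norm_nonneg _)]
    have hpt : ∀ y, ENNReal.ofReal ‖g y‖ ≤
        B.indicator (fun y => ENNReal.ofReal (l * ϑ y ^ (-(1 / (p y - 1))))) y +
          ENNReal.ofReal D * ENNReal.ofReal (‖g y‖ ^ p y * ϑ y) := fun y => by
      have hw := W.weight_pos y
      by_cases hy : y ∈ B
      · rw [indicator_of_mem hy, ← ENNReal.ofReal_mul hD.le,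
          ← ENNReal.ofReal_add (by positivity) (by positivity)]
        exact ENNReal.ofReal_le_ofReal (le_dual_add_rpow_mul (W.one_lt_exponent y)
          (W.exponent_le y) hl0 hl1 hw (norm_nonneg _))
      · simp [hgB y hy]
    calc ∫⁻ y, ENNReal.ofReal ‖g y‖ ≤ _ := lintegral_mono hpt
      _ = ENNReal.ofReal (l * J) + ENNReal.ofReal D * energy p ϑ g := by
          rw [lintegral_add_right' _ ((W.aemeasurable_integrand
            hg.norm.aestronglyMeasurable.aemeasurable).const_mul _),
            lintegral_indicator hB.measurableSet, hJ',
            lintegral_const_mul' _ _ ENNReal.ofReal_ne_top, energy_eq]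
      _ ≤ ENNReal.ofReal (ε / 2) + ENNReal.ofReal D * ENNReal.ofReal (ε / 2 / D) := by
          gcongr
      _ = ENNReal.ofReal ε := by
          rw [← ENNReal.ofReal_mul hD.le, mul_div_cancel₀ _ hD.ne',
            ← ENNReal.ofReal_add (by positivity) (by positivity), add_halves]
  exact (ENNReal.ofReal_le_ofReal_iff hε.le).1 h1

theorem measure_lt_abs_le {S : Set (EuclideanSpace ℝ (Fin d))} {f : EuclideanSpace ℝ (Fin d) → ℝ}
    {g : EuclideanSpace ℝ (Fin d) → EuclideanSpace ℝ (Fin d)} (h : IsTestPair S f g)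
    {γ : ℝ} (hγ : 0 < γ) :
    volume {y | γ < |f y|} ≤ ENNReal.ofReal ((∫ y, f y ^ 2) / γ ^ 2) := by
  have hi : Integrable fun y => f y ^ 2 := by
    simpa [sq] using h.integrable_mul h.continuous
  have hm := mul_meas_ge_le_lintegral (μ := volume) (f := fun y => ENNReal.ofReal (f y ^ 2))
    (h.continuous.pow 2).measurable.ennreal_ofReal (ENNReal.ofReal (γ ^ 2))
  rw [← ofReal_integral_eq_lintegral_ofReal hi (ae_of_all _ fun y => sq_nonneg _)] at hm
  have hsub : {y | γ < |f y|} ⊆ {y | ENNReal.ofReal (γ ^ 2) ≤ ENNReal.ofReal (f y ^ 2)} :=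
    fun y (hy : γ < |f y|) => ENNReal.ofReal_le_ofReal
      (by rw [← sq_abs (f y)]; exact pow_le_pow_left₀ hγ.le hy.le 2)
  rw [ENNReal.ofReal_div_of_pos (by positivity),
    ENNReal.le_div_iff_mul_le (Or.inl (ENNReal.ofReal_pos.2 (by positivity)).ne')
      (Or.inl ENNReal.ofReal_ne_top), mul_comm]
  exact (mul_le_mul_right (measure_mono hsub) _).trans hm

/-- Bounded test functions with small gradient in `L¹` have small modular. -/
theorem IsExponentWeight.exists_modular_le_of_integral (W : IsExponentWeight p ϑ a b) [NeZero d]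
    (x : EuclideanSpace ℝ (Fin d)) {R : ℝ} (hR : 0 ≤ R) {ε : ℝ} (hε : 0 < ε) :
    ∃ δ : ℝ, 0 < δ ∧ ∀ S f g, IsTestPair S f g → S ⊆ Metric.closedBall x R → (∀ y, |f y| ≤ 2) →
      ∫ y, ‖g y‖ ≤ δ → modular p ϑ univ f ≤ ENNReal.ofReal ε := by
  set B := Metric.closedBall x R
  have hB : IsCompact B := isCompact_closedBall x R
  have hb : 0 ≤ b := (W.exponent_pos x).le.trans (W.exponent_le x)
  set J := ∫ y in B, ϑ y
  have hJ : 0 ≤ J := integral_nonneg fun y => (W.weight_pos y).le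
  have hJ' : ∫⁻ y in B, ENNReal.ofReal (ϑ y) = ENNReal.ofReal J := by
    rw [ofReal_integral_eq_lintegral_ofReal (W.locallyIntegrable_weight.integrableOn_isCompact hB)
      (ae_of_all _ fun y => (W.weight_pos y).le)]
  -- Where `|f| ≤ γ ≤ 1` the integrand is at most `γ * ϑ`, costing `ε / 2`. Where `|f| > γ` it is at
  -- most `2 ^ b * ϑ`, on a set made small by Chebyshev and `integral_sq_le`; absolute continuity of
  -- the weight integral pays the rest.
  obtain ⟨γ, hγ0, hγ1, hγJ⟩ : ∃ γ : ℝ, 0 < γ ∧ γ ≤ 1 ∧ γ * J ≤ ε / 2 := by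
    refine ⟨min 1 (ε / 2 / (J + 1)), by positivity, min_le_left _ _, ?_⟩
    calc min 1 (ε / 2 / (J + 1)) * J ≤ ε / 2 / (J + 1) * (J + 1) := by
          gcongr
          · exact min_le_right _ _
          · linarith
      _ = ε / 2 := div_mul_cancel₀ _ (by positivity)
  set M : ℝ := 2 ^ b
  have hM : 0 < M := by positivity
  obtain ⟨η, hη, hac⟩ := exists_pos_setLIntegral_lt_of_measure_lt (μ := volume.restrict B)
    (hJ' ▸ ENNReal.ofReal_ne_top) (ε := ENNReal.ofReal (ε / 2 / M))
    (ENNReal.ofReal_pos.2 (by positivity)).ne'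
  obtain ⟨η', -, hη', hη'η⟩ := ENNReal.lt_iff_exists_real_btwn.1 hη
  have hη'0 : 0 < η' := ENNReal.ofReal_pos.1 hη'
  refine ⟨η' * γ ^ 2 / ((2 * R + 1) * (3 * 2)), by positivity, fun S f g h hS hf hg => ?_⟩
  have hfB : ∀ y ∉ B, f y = 0 := fun y hy => h.fun_eq_zero y fun hyS => hy (hS hyS)
  set s := {y | γ < |f y|}
  have hs : MeasurableSet s := (isOpen_lt continuous_const h.continuous.abs).measurableSet
  have hsmall : volume.restrict B s < η := by
    refine lt_of_le_of_lt ?_ hη'η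
    refine (Measure.restrict_apply_le _ _).trans ?_
    obtain ⟨v, hv⟩ := exists_norm_eq (EuclideanSpace ℝ (Fin d)) zero_le_one
    have h1 := h.integral_sq_le hv hR hS hf
    have h2 : ∫ y, f y ^ 2 ≤ η' * γ ^ 2 := by
      refine h1.trans ((mul_le_mul_of_nonneg_left hg (by positivity)).trans (le_of_eq ?_))
      field_simp
    refine (measure_lt_abs_le h hγ0).trans (ENNReal.ofReal_le_ofReal ?_)
    rwa [div_le_iff₀ (by positivity)]
  have hpt : ∀ y, ENNReal.ofReal (|f y| ^ p y * ϑ y) ≤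
      B.indicator (fun y => ENNReal.ofReal γ * ENNReal.ofReal (ϑ y) +
        ENNReal.ofReal M * s.indicator (fun y => ENNReal.ofReal (ϑ y)) y) y := fun y => by
    have hw := W.weight_pos y
    by_cases hy : y ∈ B
    · rw [indicator_of_mem hy]
      by_cases hys : y ∈ s
      · rw [indicator_of_mem hys]
        refine le_trans ?_ le_add_self
        rw [← ENNReal.ofReal_mul hM.le]
        refine ENNReal.ofReal_le_ofReal (mul_le_mul_of_nonneg_right ?_ hw.le)
        calc |f y| ^ p y ≤ 2 ^ p y := Real.rpow_le_rpow (abs_nonneg _) (hf y) (W.exponent_pos y).le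
          _ ≤ M := Real.rpow_le_rpow_of_exponent_le one_le_two (W.exponent_le y)
      · refine le_trans ?_ le_self_add
        rw [← ENNReal.ofReal_mul hγ0.le]
        refine ENNReal.ofReal_le_ofReal (mul_le_mul_of_nonneg_right ?_ hw.le)
        have hys' : |f y| ≤ γ := not_lt.1 hys
        calc |f y| ^ p y ≤ γ ^ p y := Real.rpow_le_rpow (abs_nonneg _) hys' (W.exponent_pos y).le
          _ ≤ γ ^ (1 : ℝ) :=
            Real.rpow_le_rpow_of_exponent_ge hγ0 hγ1 (W.one_lt_exponent y).le
          _ = γ := Real.rpow_one γ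
    · simp [hfB y hy, Real.zero_rpow (W.exponent_pos y).ne']
  rw [modular_univ]
  calc ∫⁻ y, ENNReal.ofReal (|f y| ^ p y * ϑ y) ≤ _ := lintegral_mono hpt
    _ = ENNReal.ofReal γ * ENNReal.ofReal J +
        ENNReal.ofReal M * ∫⁻ y in s, ENNReal.ofReal (ϑ y) ∂(volume.restrict B) := by
      rw [lintegral_indicator hB.measurableSet, lintegral_add_left
        (W.measurable_weight.ennreal_ofReal.const_mul _),
        lintegral_const_mul' _ _ ENNReal.ofReal_ne_top, hJ',
        lintegral_const_mul' _ _ ENNReal.ofReal_ne_top, lintegral_indicator hs]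
    _ ≤ ENNReal.ofReal (ε / 2) + ENNReal.ofReal M * ENNReal.ofReal (ε / 2 / M) := by
      rw [← ENNReal.ofReal_mul hγ0.le]
      gcongr
      exact (hac s hsmall).le
    _ = ENNReal.ofReal ε := by
      rw [← ENNReal.ofReal_mul hM.le, mul_div_cancel₀ _ hM.ne',
        ← ENNReal.ofReal_add (by positivity) (by positivity), add_halves]

/-- Bounded test functions with small energy have small modular. -/
theorem IsExponentWeight.exists_modular_le (W : IsExponentWeight p ϑ a b) [NeZero d]
    (x : EuclideanSpace ℝ (Fin d)) {R : ℝ} (hR : 0 ≤ R) {ε : ℝ} (hε : 0 < ε) :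
    ∃ δ : ℝ, 0 < δ ∧ ∀ S f g, IsTestPair S f g → S ⊆ Metric.closedBall x R → (∀ y, |f y| ≤ 2) →
      energy p ϑ g ≤ ENNReal.ofReal δ → modular p ϑ univ f ≤ ENNReal.ofReal ε := by
  obtain ⟨δ₁, hδ₁, h₁⟩ := W.exists_modular_le_of_integral x hR hε
  obtain ⟨δ, hδ, h₂⟩ := W.exists_integral_norm_le (isCompact_closedBall x R) hδ₁
  exact ⟨δ, hδ, fun S f g h hS hf hE => h₁ S f g h hS hf
    (h₂ g h.integrable_grad (fun y hy => h.grad_eq_zero y fun hyS => hy (hS hyS)) hE)⟩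

/-- Almost minimisers with almost minimal midpoint are close in energy. -/
theorem IsExponentWeight.exists_energy_sub_le_of_midpoint (W : IsExponentWeight p ϑ a b)
    {c m ε : ℝ} (hc : 0 ≤ c) (hcm : c < m) (hε : 0 < ε) :
    ∃ η : ℝ, 0 < η ∧ ∀ g₁ g₂ : EuclideanSpace ℝ (Fin d) → EuclideanSpace ℝ (Fin d),
      AEStronglyMeasurable g₁ volume → AEStronglyMeasurable g₂ volume →
      energy p ϑ g₁ ≤ ENNReal.ofReal (c + η) → energy p ϑ g₂ ≤ ENNReal.ofReal (c + η) →
      ENNReal.ofReal (c - η) ≤ energy p ϑ (fun y => (1 / 2 : ℝ) • g₁ y + (1 / 2 : ℝ) • g₂ y) →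
      energy p ϑ (fun y => g₁ y - g₂ y) ≤ ENNReal.ofReal ε ∧ c + η ≤ m := by
  have hm : 0 < m := hc.trans_lt hcm
  -- As `c + η ≤ m`, this `κ` contributes at most `ε / 2`; the defect contributes `C * ((c + η) - (c
  -- - η)) = 2 * C * η`, again at most `ε / 2`.
  obtain ⟨C, hC, h⟩ := W.exists_energy_sub_le (κ := ε / (4 * m)) (by positivity)
  obtain ⟨η, hη0, hηm, hηC⟩ : ∃ η : ℝ, 0 < η ∧ c + η ≤ m ∧ 2 * C * η ≤ ε / 2 := by
    refine ⟨min (m - c) (ε / (4 * (C + 1))), lt_min (by linarith) (by positivity), ?_, ?_⟩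
    · linarith [min_le_left (m - c) (ε / (4 * (C + 1)))]
    · calc 2 * C * min (m - c) (ε / (4 * (C + 1))) ≤ 2 * C * (ε / (4 * (C + 1))) := by
            gcongr
            exact min_le_right _ _
        _ ≤ 2 * (C + 1) * (ε / (4 * (C + 1))) := by
            gcongr
            linarith
        _ = ε / 2 := by field_simp; norm_num
  refine ⟨η, hη0, fun g₁ g₂ m₁ m₂ h₁ h₂ h₁₂ => ⟨?_, hηm⟩⟩
  have key := h g₁ g₂ m₁ m₂
  have k2 : energy p ϑ (fun y => g₁ y - g₂ y) + ENNReal.ofReal (C * max (c - η) 0) ≤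
      ENNReal.ofReal ((ε / (4 * m) + C / 2) * ((c + η) + (c + η))) := by
    rw [ENNReal.ofReal_mul hC, ENNReal.ofReal_mul (by positivity),
      ENNReal.ofReal_add (p := c + η) (by positivity) (by positivity)]
    refine le_trans (add_le_add_right (mul_le_mul_right ?_ _) _)
      (key.trans (mul_le_mul_right (add_le_add h₁ h₂) _))
    rcases le_total (c - η) 0 with h0 | h0
    · simp [max_eq_right h0]
    · rwa [max_eq_left h0]
  refine (ENNReal.le_sub_of_add_le_right ENNReal.ofReal_ne_top k2).trans ?_
  rw [← ENNReal.ofReal_sub _ (by positivity)]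
  refine ENNReal.ofReal_le_ofReal ?_
  have h3 : C * (c - η) ≤ C * max (c - η) 0 := by gcongr; exact le_max_left _ _
  have h4 : ε / (4 * m) * ((c + η) + (c + η)) ≤ ε / 2 := by
    calc ε / (4 * m) * ((c + η) + (c + η)) ≤ ε / (4 * m) * (m + m) := by gcongr
      _ = ε / 2 := by field_simp; norm_num
  nlinarith

/-- The energy of a gradient perturbed by a localised error. -/
theorem IsExponentWeight.exists_energy_perturb_le (W : IsExponentWeight p ϑ a b)
    {Λ L : ℝ} (hΛ : 1 < Λ) :
    ∃ C : ℝ, 0 ≤ C ∧ ∀ (g k G : EuclideanSpace ℝ (Fin d) → EuclideanSpace ℝ (Fin d))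
      (h : EuclideanSpace ℝ (Fin d) → ℝ), AEStronglyMeasurable g volume →
      AEStronglyMeasurable k volume → (∀ y, ‖G y‖ ≤ ‖g y‖ + (‖k y‖ + L * |h y|)) →
      energy p ϑ G ≤ ENNReal.ofReal Λ * energy p ϑ g +
        ENNReal.ofReal C * (energy p ϑ k + modular p ϑ univ h) := by
  have hb : 0 ≤ b := (W.exponent_pos 0).le.trans (W.exponent_le 0)
  obtain ⟨C₁, hC₁, H₁⟩ := exists_add_rpow_le hb hΛ
  obtain ⟨C₂, hC₂, H₂⟩ := exists_add_rpow_le hb one_lt_two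
  set A : ℝ := max 1 L ^ b
  have hA : 0 ≤ A := by positivity
  refine ⟨C₁ * (2 + C₂ * A), by positivity, fun g k G h hg hk hG => ?_⟩
  rw [modular_univ]
  simp only [energy_eq]
  rw [← lintegral_add_left' (W.aemeasurable_integrand hk.norm.aemeasurable),
    ← lintegral_const_mul' _ _ ENNReal.ofReal_ne_top,
    ← lintegral_const_mul' _ _ ENNReal.ofReal_ne_top,
    ← lintegral_add_left' ((W.aemeasurable_integrand hg.norm.aemeasurable).const_mul _)]
  refine lintegral_mono fun y => ?_
  have hw := (W.weight_pos y).le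
  have hq : p y ∈ Icc 0 b := ⟨(W.exponent_pos y).le, W.exponent_le y⟩
  dsimp only
  rw [← ENNReal.ofReal_add (by positivity) (by positivity), ← ENNReal.ofReal_mul (by positivity),
    ← ENNReal.ofReal_mul (by positivity), ← ENNReal.ofReal_add (by positivity) (by positivity)]
  refine ENNReal.ofReal_le_ofReal ?_
  have e1 : ‖G y‖ ^ p y ≤ (‖g y‖ + (‖k y‖ + max 1 L * |h y|)) ^ p y := by
    refine Real.rpow_le_rpow (norm_nonneg _) ((hG y).trans ?_) hq.1
    have : L * |h y| ≤ max 1 L * |h y| :=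
      mul_le_mul_of_nonneg_right (le_max_right _ _) (abs_nonneg _)
    linarith
  have e2 := H₁ (p y) hq ‖g y‖ (‖k y‖ + max 1 L * |h y|) (norm_nonneg _) (by positivity)
  have e3 := H₂ (p y) hq ‖k y‖ (max 1 L * |h y|) (norm_nonneg _) (by positivity)
  have e4 : (max 1 L * |h y|) ^ p y ≤ A * |h y| ^ p y := by
    rw [Real.mul_rpow (by positivity) (abs_nonneg _)]
    exact mul_le_mul_of_nonneg_right
      (Real.rpow_le_rpow_of_exponent_le (le_max_left _ _) hq.2) (by positivity)
  have e5 : (‖k y‖ + max 1 L * |h y|) ^ p y ≤ (2 + C₂ * A) * (‖k y‖ ^ p y + |h y| ^ p y) := by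
    have z1 := mul_le_mul_of_nonneg_left e4 hC₂
    have z2 : 0 ≤ C₂ * A * ‖k y‖ ^ p y := by positivity
    have z3 : 0 ≤ |h y| ^ p y := by positivity
    nlinarith
  have e6 := mul_le_mul_of_nonneg_left e5 hC₁
  have e7 := mul_le_mul_of_nonneg_right (e1.trans (e2.trans (add_le_add_right e6 _))) hw
  refine e7.trans (le_of_eq ?_)
  ring

/-! ### Stability of capacity when the reference set shrinks -/

/-- The capacity of a set `V` inside a compact subset of `Ω` is approximated by capacities relative
to smaller sets `Ω'`. -/
theorem IsExponentWeight.exists_capOpen_le (W : IsExponentWeight p ϑ a b) [NeZero d]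
    {V K₀ Ω : Set (EuclideanSpace ℝ (Fin d))} (hK₀ : IsCompact K₀) (hVK₀ : V ⊆ K₀) (hΩ : IsOpen Ω)
    (hK₀Ω : K₀ ⊆ Ω) {x : EuclideanSpace ℝ (Fin d)} {R : ℝ} (hR : 0 ≤ R)
    (hΩR : Ω ⊆ Metric.closedBall x R) {t : ℝ≥0∞} (ht : capOpen p ϑ V Ω < t) :
    ∃ S, IsCompact S ∧ S ⊆ Ω ∧ ∀ Ω', S ⊆ Ω' → capOpen p ϑ V Ω' ≤ t := by
  have hne : capOpen p ϑ V Ω ≠ ∞ := (ht.trans_le le_top).ne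
  -- Three levels split the slack: the energy of `v` stays below `m`, the factor `Λ = m₂ / m` raises
  -- it to `m₂`, and the perturbation fits into `m₃ - m₂`.
  obtain ⟨m₃, hm₃, h₃, h₃t⟩ := ENNReal.lt_iff_exists_real_btwn.1 ht
  obtain ⟨m₂, hm₂, h₂, h₂₃⟩ := ENNReal.lt_iff_exists_real_btwn.1 h₃
  obtain ⟨m, hm, h₁, h₁₂⟩ := ENNReal.lt_iff_exists_real_btwn.1 h₂
  set c := (capOpen p ϑ V Ω).toReal with hc_def
  have hc : ENNReal.ofReal c = capOpen p ϑ V Ω := ENNReal.ofReal_toReal hne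
  have hc0 : 0 ≤ c := ENNReal.toReal_nonneg
  have hcm : c < m := by
    rw [← hc] at h₁; exact (ENNReal.ofReal_lt_ofReal_iff_of_nonneg hc0).1 h₁
  have hm₁₂ : m < m₂ := (ENNReal.ofReal_lt_ofReal_iff_of_nonneg hm).1 h₁₂
  have hm₂₃ : m₂ < m₃ := (ENNReal.ofReal_lt_ofReal_iff_of_nonneg hm₂).1 h₂₃
  have hm0 : 0 < m := hc0.trans_lt hcm
  obtain ⟨χ, hχ, hχc, hχΩ, hχ1, hχI⟩ := exists_smooth_cutoff hK₀ hΩ hK₀Ω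
  obtain ⟨L, hL⟩ := (IsTestPair.continuous_gradient hχ).bounded_above_of_compact_support
    (HasCompactSupport.intro hχc fun y hy => IsTestPair.gradient_eq_zero_of_notMem_tsupport hy)
  obtain ⟨C, hC, HC⟩ := W.exists_energy_perturb_le (Λ := m₂ / m) (L := L)
    ((one_lt_div hm0).2 hm₁₂)
  obtain ⟨ε, hε, hεC⟩ : ∃ ε : ℝ, 0 < ε ∧ C * (ε + ε) ≤ m₃ - m₂ := by
    refine ⟨(m₃ - m₂) / (2 * (C + 1)), div_pos (by linarith) (by positivity), ?_⟩
    rw [← add_div, ← mul_div_assoc, div_le_iff₀ (by positivity)]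
    nlinarith
  obtain ⟨δ, hδ, Hδ⟩ := W.exists_modular_le x hR hε
  obtain ⟨η, hη, Hη⟩ := W.exists_energy_sub_le_of_midpoint hc0 hcm (lt_min hε hδ)
  obtain ⟨K₁, hK₁, hK₁V, hcK₁⟩ : ∃ K₁, IsCompact K₁ ∧ K₁ ⊆ V ∧
      ENNReal.ofReal (c - η) ≤ capCompact p ϑ K₁ Ω := by
    rcases hc0.eq_or_lt with h0 | h0
    · refine ⟨∅, isCompact_empty, empty_subset _, ?_⟩
      rw [ENNReal.ofReal_of_nonpos (by linarith)]
      exact zero_le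
    · have hlt : ENNReal.ofReal (c - η) < capOpen p ϑ V Ω := by
        rw [← hc]; exact (ENNReal.ofReal_lt_ofReal_iff h0).2 (by linarith)
      simp only [capOpen, lt_iSup_iff] at hlt
      obtain ⟨K₁, hK₁, hK₁V, hlt⟩ := hlt
      exact ⟨K₁, hK₁, hK₁V, hlt.le⟩
  have hcap : ∀ K, IsCompact K → K ⊆ V → capCompact p ϑ K Ω < ENNReal.ofReal (c + η) :=
    fun K hK hKV => 
      have h4 : capCompact p ϑ K Ω ≤ capOpen p ϑ V Ω :=
        le_iSup₂_of_le K hK (le_iSup_of_le hKV le_rfl)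
      h4.trans_lt (hc.symm.trans_lt ((ENNReal.ofReal_lt_ofReal_iff (by linarith)).2 (by linarith)))
  obtain ⟨Sv, v, gv, hv, hSv, hvK, hv0, hv2, hvE⟩ :=
    exists_isTestPair_of_capCompact_lt W hΩ (hcap K₁ hK₁ hK₁V)
  -- This compact set depends on `K₁` and `χ` only, so it serves every compact `K ⊆ V`.
  refine ⟨Sv ∪ tsupport χ, hv.isCompact.union hχc, union_subset hSv hχΩ, fun Ω' hΩ' =>
    iSup₂_le fun K hK => iSup_le fun hKV => ?_⟩
  -- Including `K₁` makes the midpoint of `v` and `w` a competitor for `K₁`, so its energy is at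
  -- least `c - η`.
  obtain ⟨Sw, w, gw, hw, hSw, hwK, hw0, hw2, hwE⟩ :=
    exists_isTestPair_of_capCompact_lt W hΩ (hcap (K ∪ K₁) (hK.union hK₁)
      (union_subset hKV hK₁V))
  have hS := hv.isCompact.union hw.isCompact
  have hv' := hv.mono hS subset_union_left
  have hw' := hw.mono hS subset_union_right
  have hSΩ : Sv ∪ Sw ⊆ Ω := union_subset hSv hSw
  have hmid : capCompact p ϑ K₁ Ω ≤ _ := (hw'.linearComb hv' (1 / 2) (1 / 2)).capCompact_le W hSΩ
    (fun y hy => by linarith [hvK y hy, hwK y (Or.inr hy)])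
    (fun y => by linarith [hv0 y, hw0 y])
  obtain ⟨hE, hηm⟩ := Hη gw gv hw.integrable_grad.aestronglyMeasurable
    hv.integrable_grad.aestronglyMeasurable hwE.le hvE.le (hcK₁.trans hmid)
  have hh := hw'.linearComb hv' 1 (-1)
  have e1 : ∀ y, (1 : ℝ) • gw y + (-1 : ℝ) • gv y = gw y - gv y := fun y => by
    rw [one_smul, neg_one_smul, sub_eq_add_neg]
  simp only [e1] at hh
  have hmod := Hδ _ _ _ hh (hSΩ.trans hΩR)
    (fun y => abs_le.2 ⟨by linarith [hv2 y, hw0 y], by linarith [hw2 y, hv0 y]⟩)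
    (hE.trans (ENNReal.ofReal_le_ofReal (min_le_right _ _)))
  have hS' := hv.isCompact.union hχc
  -- The glued function is `v + χ (w - v) = (1 - χ) v + χ w`: nonnegative, and equal to `w` on `K`.
  have hG := (hv.mono hS' subset_union_left).linearComb
    ((hh.mul_smooth hχ hχc).mono hS' subset_union_right) 1 1
  have hfin := hG.capCompact_le (K := K) W hΩ' (fun y hy => by
      have : χ y = 1 := ((eventually_nhdsSet_iff_forall.1 hχ1) y (hVK₀ (hKV hy))).self_of_nhds
      rw [this]
      linarith [hwK y (Or.inl hy)])
    (fun y => by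
      have h1 := (hχI y).1
      have h2 := (hχI y).2
      nlinarith [mul_nonneg h1 (hw0 y), mul_nonneg (sub_nonneg.2 h2) (hv0 y)])
  refine hfin.trans ((HC gv (fun y => gw y - gv y) _ _ hv.integrable_grad.aestronglyMeasurable
    (hw.integrable_grad.sub hv.integrable_grad).aestronglyMeasurable fun y => ?_).trans
    (le_trans (add_le_add (mul_le_mul_right (hvE.le.trans (ENNReal.ofReal_le_ofReal hηm)) _)
    (mul_le_mul_right (add_le_add (hE.trans (ENNReal.ofReal_le_ofReal (min_le_left _ _))) hmod) _))
    ?_))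
  · rw [one_smul, one_smul]
    refine (norm_add_le _ _).trans (add_le_add_right ((norm_add_le _ _).trans (add_le_add ?_ ?_)) _)
    · rw [norm_smul, Real.norm_eq_abs, abs_of_nonneg (hχI y).1]
      exact mul_le_of_le_one_left (norm_nonneg _) (hχI y).2
    · rw [norm_smul, mul_comm, Real.norm_eq_abs]
      gcongr
      exact hL y
  · rw [← ENNReal.ofReal_add hε.le hε.le, ← ENNReal.ofReal_mul (by positivity),
      ← ENNReal.ofReal_mul hC, ← ENNReal.ofReal_add (by positivity) (by positivity),
      div_mul_cancel₀ _ hm0.ne']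
    exact (ENNReal.ofReal_le_ofReal (by linarith)).trans h₃t.le

theorem relCap_mono {E E' Ω : Set (EuclideanSpace ℝ (Fin d))} (h : E ⊆ E') :
    relCap p ϑ E Ω ≤ relCap p ϑ E' Ω :=
  iInf₂_mono fun _ _ => iInf_mono' fun hE' => ⟨h.trans hE', le_rfl⟩

theorem relCap_le_capOpen {E U Ω : Set (EuclideanSpace ℝ (Fin d))} (hU : IsOpen U) (hE : E ⊆ U)
    (hΩ : U ⊆ Ω) : relCap p ϑ E Ω ≤ capOpen p ϑ U Ω :=
  iInf₂_le_of_le U hU (iInf₂_le_of_le hE hΩ le_rfl)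

/-! ### Control of ball capacities on intervals of radii -/

/-- The capacity of `E ∩ B(x, r)` relative to `B(x, 2r)`. -/
noncomputable def ballCap (p ϑ : EuclideanSpace ℝ (Fin d) → ℝ)
    (E : Set (EuclideanSpace ℝ (Fin d))) (x : EuclideanSpace ℝ (Fin d)) (r : ℝ) : ℝ≥0∞ :=
  relCap p ϑ (E ∩ Metric.ball x r) (Metric.ball x (2 * r))

/-- A single open set controls the capacity of `A` at all radii in `(α, β)` by `t`. -/
def IsControlled (p ϑ : EuclideanSpace ℝ (Fin d) → ℝ) (A : Set (EuclideanSpace ℝ (Fin d)))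
    (x : EuclideanSpace ℝ (Fin d)) (α β : ℝ) (t : ℝ≥0∞) : Prop :=
  ∃ V, IsOpen V ∧ A ∩ Metric.closedBall x β ⊆ V ∧ capOpen p ϑ V (Metric.ball x (2 * α)) ≤ t

variable {A : Set (EuclideanSpace ℝ (Fin d))} {x : EuclideanSpace ℝ (Fin d)}

theorem IsControlled.mono (W : IsExponentWeight p ϑ a b) {α α' β β' : ℝ} {t : ℝ≥0∞}
    (h : IsControlled p ϑ A x α β t) (hα : α ≤ α') (hβ : β' ≤ β) :
    IsControlled p ϑ A x α' β' t := by
  obtain ⟨V, hV, hAV, ht⟩ := h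
  exact ⟨V, hV, (inter_subset_inter_right _ (Metric.closedBall_subset_closedBall hβ)).trans hAV,
    (capOpen_mono W Metric.isOpen_ball subset_rfl
      (Metric.ball_subset_ball (by linarith))).trans ht⟩

theorem ballCap_le_of_subset (W : IsExponentWeight p ϑ a b)
    {U V : Set (EuclideanSpace ℝ (Fin d))} (hV : IsOpen V) {α r : ℝ} (hαr : α < r)
    (hr : 0 ≤ r) (hUV : U ∩ Metric.ball x r ⊆ V) {t : ℝ≥0∞}
    (ht : capOpen p ϑ V (Metric.ball x (2 * α)) ≤ t) : ballCap p ϑ U x r ≤ t :=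
  (relCap_le_capOpen (hV.inter Metric.isOpen_ball) (subset_inter hUV inter_subset_right)
    (inter_subset_right.trans (Metric.ball_subset_ball (by linarith)))).trans
    ((capOpen_mono W Metric.isOpen_ball inter_subset_left
      (Metric.ball_subset_ball (by linarith))).trans ht)

theorem IsControlled.ballCap_le (W : IsExponentWeight p ϑ a b) {α β r : ℝ} {t : ℝ≥0∞}
    (h : IsControlled p ϑ A x α β t) (hr : 0 ≤ r) (hα : α < r) (hβ : r < β) :
    ballCap p ϑ A x r ≤ t := by
  obtain ⟨V, hV, hAV, ht⟩ := h
  exact ballCap_le_of_subset W hV hα hr ((inter_subset_inter_right _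
    (Metric.ball_subset_closedBall.trans (Metric.closedBall_subset_closedBall hβ.le))).trans hAV) ht

/-- `V ∩ B(x, r)` lies in a compact subset of `B(x, 2r)`, so `exists_capOpen_le` bounds its capacity
relative to a ball of radius below `2 * r`. -/
theorem exists_isControlled_left (W : IsExponentWeight p ϑ a b) [NeZero d] {r : ℝ} (hr : 0 < r)
    {t : ℝ≥0∞} (ht : ballCap p ϑ A x r < t) :
    ∃ α < r, ∀ β < r, IsControlled p ϑ A x α β t := by
  simp only [ballCap, relCap, iInf_lt_iff] at ht
  obtain ⟨V, hV, hAV, -, ht⟩ := ht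
  have ht' : capOpen p ϑ (V ∩ Metric.ball x r) (Metric.ball x (2 * r)) < t :=
    (capOpen_mono W Metric.isOpen_ball inter_subset_left subset_rfl).trans_lt ht
  obtain ⟨S, hS, hSr, H⟩ := W.exists_capOpen_le (isCompact_closedBall x r)
    (inter_subset_right.trans Metric.ball_subset_closedBall) Metric.isOpen_ball
    (Metric.closedBall_subset_ball (by linarith)) (R := 2 * r) (by positivity)
    Metric.ball_subset_closedBall ht'
  obtain ⟨ρ, hρ, hSρ⟩ := exists_lt_subset_ball hS.isClosed hSr
  refine ⟨ρ / 2, by linarith, fun β hβ => ⟨V ∩ Metric.ball x r, hV.inter Metric.isOpen_ball, ?_,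
    H _ (by rwa [mul_div_cancel₀ _ two_ne_zero])⟩⟩
  have hAβ : A ∩ Metric.closedBall x β ⊆ A ∩ Metric.ball x r :=
    inter_subset_inter_right _ (Metric.closedBall_subset_ball hβ)
  exact subset_inter (hAβ.trans hAV) (hAβ.trans inter_subset_right)

theorem countable_of_forall_left_gap {s : Set ℝ} (h : ∀ r ∈ s, ∃ α < r, Disjoint (Ioo α r) s) :
    s.Countable := by
  refine (countable_setOfPred_isolated_left_within (s := s)).mono fun r hr => ?_
  obtain ⟨α, hα, hd⟩ := h r hr
  refine mem_ofPred_eq.mpr ⟨hr, ?_⟩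
  rw [← empty_mem_iff_bot, mem_nhdsWithin]
  exact ⟨Ioi α, isOpen_Ioi, hα, fun z hz => hd.ne_of_mem ⟨hz.1, hz.2.2⟩ hz.2.1 rfl⟩

/-- Points of `s` outside its interior are isolated from the left among themselves, hence countable
in number. -/
theorem measurableSet_of_forall_left_Ioo {s : Set ℝ} (h : ∀ r ∈ s, ∃ α < r, Ioo α r ⊆ s) :
    MeasurableSet s := by
  have hc : (s \ interior s).Countable := by
    refine countable_of_forall_left_gap fun r hr => ?_
    obtain ⟨α, hα, hs⟩ := h r hr.1
    exact ⟨α, hα, disjoint_left.2 fun z hz hz' => hz'.2 (interior_maximal hs isOpen_Ioo hz)⟩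
  rw [← union_sdiff_cancel (interior_subset (s := s))]
  exact isOpen_interior.measurableSet.union hc.measurableSet

theorem measurable_ballCap (W : IsExponentWeight p ϑ a b) [NeZero d]
    (A : Set (EuclideanSpace ℝ (Fin d))) (x : EuclideanSpace ℝ (Fin d)) :
    Measurable (ballCap p ϑ A x) := by
  refine measurable_of_Iio fun t => measurableSet_of_forall_left_Ioo fun r hr => ?_
  have hr' : ballCap p ϑ A x r < t := hr
  rcases le_or_gt r 0 with h0 | h0
  · refine ⟨r - 1, by linarith, fun z hz => ?_⟩
    have e : ballCap p ϑ A x z = ballCap p ϑ A x r := by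
      have hz0 : z ≤ 0 := hz.2.le.trans h0
      simp only [ballCap, Metric.ball_eq_empty.2 h0, Metric.ball_eq_empty.2 hz0,
        Metric.ball_eq_empty.2 (show 2 * r ≤ 0 by linarith),
        Metric.ball_eq_empty.2 (show 2 * z ≤ 0 by linarith)]
    exact (e.trans_lt hr' : ballCap p ϑ A x z < t)
  · obtain ⟨t', h1, h2⟩ := exists_between hr'
    obtain ⟨α, hα, H⟩ := exists_isControlled_left W h0 h1
    refine ⟨max α 0, max_lt hα h0, fun z hz => ?_⟩
    obtain ⟨β, hβ, hβr⟩ := exists_between hz.2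
    exact ((H β hβr).ballCap_le W ((le_max_right _ _).trans hz.1.le)
      ((le_max_left _ _).trans_lt hz.1) hβ).trans_lt h2

/-- For fixed `q`, a bad radius `r` is controlled on an interval `(α, r)`, which therefore contains
no bad radius; so the bad radii are countable. -/
theorem ae_exists_isControlled (W : IsExponentWeight p ϑ a b) [NeZero d]
    (A : Set (EuclideanSpace ℝ (Fin d))) (x : EuclideanSpace ℝ (Fin d)) :
    ∀ᵐ r : ℝ, 0 < r → ∀ q : ℚ, ballCap p ϑ A x r < ENNReal.ofReal q →
      ∃ α β : ℚ, (α : ℝ) < r ∧ r < β ∧ IsControlled p ϑ A x α β (ENNReal.ofReal q) := by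
  have hc : ∀ q : ℚ, {r : ℝ | 0 < r ∧ ballCap p ϑ A x r < ENNReal.ofReal q ∧
      ¬ ∃ α β : ℚ, (α : ℝ) < r ∧ r < β ∧
        IsControlled p ϑ A x α β (ENNReal.ofReal q)}.Countable := fun q => by
    refine countable_of_forall_left_gap fun r hr => ?_
    obtain ⟨α, hα, H⟩ := exists_isControlled_left W hr.1 hr.2.1
    refine ⟨α, hα, disjoint_left.2 fun z hz hz' => hz'.2.2 ?_⟩
    obtain ⟨β, hβ, hβr⟩ := exists_rat_btwn hz.2
    obtain ⟨α', hα', hα'z⟩ := exists_rat_btwn hz.1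
    exact ⟨α', β, hα'z, hβ, (H β hβr).mono W hα'.le le_rfl⟩
  filter_upwards [(countable_iUnion hc).ae_notMem volume] with r hr h0 q hq
  by_contra hne
  exact hr (mem_iUnion.2 ⟨q, h0, hq, hne⟩)

open Classical in
/-- The bound on the capacity at radius `r` provided by the triple `(α, β, q)`. -/
noncomputable def tripleBound (p ϑ : EuclideanSpace ℝ (Fin d) → ℝ)
    (A : Set (EuclideanSpace ℝ (Fin d))) (x : EuclideanSpace ℝ (Fin d)) (z : ℚ × ℚ × ℚ)
    (r : ℝ) : ℝ≥0∞ :=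
  if IsControlled p ϑ A x z.1 z.2.1 (ENNReal.ofReal z.2.2) ∧ r ∈ Ioo (z.1 : ℝ) z.2.1
    then ENNReal.ofReal z.2.2 else ∞

theorem measurable_tripleBound (z : ℚ × ℚ × ℚ) : Measurable (tripleBound p ϑ A x z) :=
  Measurable.ite ((MeasurableSet.const _).inter measurableSet_Ioo) measurable_const measurable_const

theorem ae_iInf_tripleBound_le (W : IsExponentWeight p ϑ a b) [NeZero d]
    (A : Set (EuclideanSpace ℝ (Fin d))) (x : EuclideanSpace ℝ (Fin d)) :
    ∀ᵐ r : ℝ, 0 < r → ⨅ z, tripleBound p ϑ A x z r ≤ ballCap p ϑ A x r := by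
  filter_upwards [ae_exists_isControlled W A x] with r hr h0
  refine le_of_forall_gt fun t ht => ?_
  obtain ⟨q, -, hq, hqt⟩ := ENNReal.lt_iff_exists_rat_btwn.1 ht
  obtain ⟨α, β, hα, hβ, hc⟩ := hr h0 q hq
  refine (iInf_le _ (α, β, q)).trans_lt (lt_of_le_of_lt ?_ hqt)
  rw [tripleBound, if_pos ⟨hc, hα, hβ⟩]
  exact le_rfl

/-! ### Finitely many open sets on each dyadic shell -/

open Classical in
/-- The capacity ratio with numerator `c`, capped at `1`. -/
noncomputable def cappedRatio (p ϑ : EuclideanSpace ℝ (Fin d) → ℝ)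
    (x : EuclideanSpace ℝ (Fin d)) (c : ℝ≥0∞) (r : ℝ) : ℝ≥0∞ :=
  if ballCap p ϑ univ x r = 0 then 1 else min 1 (c / ballCap p ϑ univ x r)

theorem cappedRatio_mono (x : EuclideanSpace ℝ (Fin d)) (r : ℝ) {c c' : ℝ≥0∞} (h : c ≤ c') :
    cappedRatio p ϑ x c r ≤ cappedRatio p ϑ x c' r := by
  unfold cappedRatio
  split_ifs
  · exact le_rfl
  · exact min_le_min le_rfl (ENNReal.div_le_div_right h _)

theorem cappedRatio_le_one (x : EuclideanSpace ℝ (Fin d)) (r : ℝ) (c : ℝ≥0∞) :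
    cappedRatio p ϑ x c r ≤ 1 := by
  unfold cappedRatio
  split_ifs
  · exact le_rfl
  · exact min_le_left _ _

/-- Monotonicity already makes the ratio at most `1`, so the cap changes nothing here. It matters
for the bounds `finiteBound`, which may be infinite and need an integrable majorant. -/
theorem capRatio_eq_cappedRatio (E : Set (EuclideanSpace ℝ (Fin d)))
    (x : EuclideanSpace ℝ (Fin d)) (r : ℝ) :
    capRatio p ϑ E x r = cappedRatio p ϑ x (ballCap p ϑ E x r) r := by
  have e : ballCap p ϑ univ x r = relCap p ϑ (Metric.ball x r) (Metric.ball x (2 * r)) := by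
    rw [ballCap, univ_inter]
  unfold cappedRatio capRatio
  rw [e]
  split_ifs
  · rfl
  · rw [min_eq_right (ENNReal.div_le_of_le_mul ?_)]
    · rfl
    · rw [one_mul]; exact relCap_mono inter_subset_right

theorem tendsto_cappedRatio (x : EuclideanSpace ℝ (Fin d)) (r : ℝ) {c : ℕ → ℝ≥0∞} {c' : ℝ≥0∞}
    (h : Tendsto c atTop (𝓝 c')) :
    Tendsto (fun n => cappedRatio p ϑ x (c n) r) atTop (𝓝 (cappedRatio p ϑ x c' r)) := by
  unfold cappedRatio
  split_ifs with h0
  · exact tendsto_const_nhds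
  · exact tendsto_const_nhds.min (ENNReal.Tendsto.div_const h (Or.inr h0))

theorem measurable_cappedRatio (W : IsExponentWeight p ϑ a b) [NeZero d]
    (x : EuclideanSpace ℝ (Fin d)) {c : ℝ → ℝ≥0∞} (hc : Measurable c) :
    Measurable fun r => cappedRatio p ϑ x (c r) r :=
  have hD := measurable_ballCap W univ x
  Measurable.ite (hD (measurableSet_singleton 0)) measurable_const
    (measurable_const.min (hc.div hD))

/-- The minimum of the first `n` bounds in an enumeration of triples. -/
noncomputable def finiteBound (p ϑ : EuclideanSpace ℝ (Fin d) → ℝ)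
    (A : Set (EuclideanSpace ℝ (Fin d))) (x : EuclideanSpace ℝ (Fin d)) (e : ℕ → ℚ × ℚ × ℚ)
    (n : ℕ) (r : ℝ) : ℝ≥0∞ :=
  ⨅ m, ⨅ _ : m < n, tripleBound p ϑ A x (e m) r

theorem tendsto_finiteBound {e : ℕ → ℚ × ℚ × ℚ} (he : Function.Surjective e) (r : ℝ) :
    Tendsto (fun n => finiteBound p ϑ A x e n r) atTop (𝓝 (⨅ z, tripleBound p ϑ A x z r)) := by
  have hanti : Antitone fun n => finiteBound p ϑ A x e n r := fun n n' hn => by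
    unfold finiteBound
    exact le_iInf fun m => le_iInf fun hm =>
      iInf_le_of_le m (iInf_le_of_le (lt_of_lt_of_le hm hn) le_rfl)
  convert tendsto_atTop_iInf hanti
  refine le_antisymm (le_iInf fun n => le_iInf₂ fun m _ => iInf_le _ _) (le_iInf fun z => ?_)
  obtain ⟨m, rfl⟩ := he z
  exact iInf_le_of_le (m + 1) (iInf₂_le m m.lt_succ_self)

/-- On an interval away from `0`, finitely many triples suffice up to a small error. -/
theorem exists_finiteBound_lintegral_le (W : IsExponentWeight p ϑ a b) [NeZero d]
    {e : ℕ → ℚ × ℚ × ℚ} (he : Function.Surjective e) {κ : ℝ} (hκ : 0 ≤ κ) {I : Set ℝ}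
    (hI : MeasurableSet I) {l : ℝ} (hl : 0 < l) (hIl : I ⊆ Ioo l 1) {ε : ℝ≥0∞} (hε : ε ≠ 0)
    (hA : ∫⁻ r in I, capRatio p ϑ A x r ^ κ * ENNReal.ofReal (1 / r) ≠ ∞) :
    ∃ n, ∫⁻ r in I, cappedRatio p ϑ x (finiteBound p ϑ A x e n r) r ^ κ * ENNReal.ofReal (1 / r)
      ≤ (∫⁻ r in I, capRatio p ϑ A x r ^ κ * ENNReal.ofReal (1 / r)) + ε := by
  have hvol : volume I ≠ ∞ := ((measure_mono hIl).trans_lt measure_Ioo_lt_top).ne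
  have hmeas : ∀ n, Measurable (finiteBound p ϑ A x e n) := fun n =>
    Measurable.iInf fun m => Measurable.iInf fun _ => measurable_tripleBound (e m)
  have hinv : Measurable fun r : ℝ => ENNReal.ofReal (1 / r) :=
    (measurable_const.div measurable_id).ennreal_ofReal
  have lim := tendsto_lintegral_of_dominated_convergence (μ := volume.restrict I)
    (F := fun n r => cappedRatio p ϑ x (finiteBound p ϑ A x e n r) r ^ κ * ENNReal.ofReal (1 / r))
    (f := fun r => cappedRatio p ϑ x (⨅ z, tripleBound p ϑ A x z r) r ^ κ *
      ENNReal.ofReal (1 / r)) (fun _ => ENNReal.ofReal (1 / l))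
    (fun n => ((measurable_cappedRatio W x (hmeas n)).pow_const κ).mul hinv)
    (fun n => (ae_restrict_iff' hI).2 (ae_of_all _ fun r hr => by
      calc cappedRatio p ϑ x (finiteBound p ϑ A x e n r) r ^ κ * ENNReal.ofReal (1 / r)
          ≤ 1 * ENNReal.ofReal (1 / l) := by
            gcongr
            · exact ENNReal.rpow_le_one (cappedRatio_le_one x r _) hκ
            · exact (hIl hr).1.le
        _ = ENNReal.ofReal (1 / l) := one_mul _))
    (by rw [setLIntegral_const]; exact ENNReal.mul_ne_top ENNReal.ofReal_ne_top hvol)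
    (ae_of_all _ fun r => ENNReal.Tendsto.mul_const
      ((tendsto_cappedRatio x r (tendsto_finiteBound he r)).ennrpow_const κ)
      (Or.inr ENNReal.ofReal_ne_top))
  have hle : ∫⁻ r in I, cappedRatio p ϑ x (⨅ z, tripleBound p ϑ A x z r) r ^ κ *
      ENNReal.ofReal (1 / r) ≤ ∫⁻ r in I, capRatio p ϑ A x r ^ κ * ENNReal.ofReal (1 / r) := by
    refine lintegral_mono_ae ((ae_restrict_iff' hI).2 ?_)
    filter_upwards [ae_iInf_tripleBound_le W A x] with r hr hrI
    rw [capRatio_eq_cappedRatio]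
    gcongr
    exact cappedRatio_mono x r (hr (hl.trans (hIl hrI).1))
  obtain ⟨n, hn⟩ := (lim.eventually_lt_const
    (hle.trans_lt (ENNReal.lt_add_right hA hε))).exists
  exact ⟨n, hn.le⟩

/-! ### Assembly of the open set -/

/-- The open set cut out by the first `n j` members of the family `V` at scale `2 ^ (-j)`. -/
def scaleOpen (x : EuclideanSpace ℝ (Fin d)) (V : ℕ → Set (EuclideanSpace ℝ (Fin d)))
    (β : ℕ → ℝ) (n : ℕ → ℕ) : Set (EuclideanSpace ℝ (Fin d)) :=
  {x}ᶜ ∩ ⋂ j, ⋂ m, ⋂ _ : m < n j, (V m ∪ {y | min (β m) ((1 / 2) ^ j) < dist y x})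

/-- Near `y ≠ x`, every condition of scale `j` with `2 ^ (-j) < dist y x / 2` holds automatically by
the distance alternative, so only finitely many open conditions remain. -/
theorem isOpen_scaleOpen {V : ℕ → Set (EuclideanSpace ℝ (Fin d))} (hV : ∀ m, IsOpen (V m))
    (β : ℕ → ℝ) (n : ℕ → ℕ) : IsOpen (scaleOpen x V β n) := by
  have hfar : ∀ c : ℝ, IsOpen {y : EuclideanSpace ℝ (Fin d) | c < dist y x} := fun c =>
    isOpen_lt continuous_const (continuous_id.dist continuous_const)
  refine isOpen_iff_mem_nhds.2 fun y hy => ?_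
  have hyx : 0 < dist y x := dist_pos.2 hy.1
  obtain ⟨J, hJ⟩ := exists_pow_lt_of_lt_one (half_pos hyx) (show (1 / 2 : ℝ) < 1 by norm_num)
  have hN : IsOpen ({z : EuclideanSpace ℝ (Fin d) | dist y x / 2 < dist z x} ∩
      ⋂ j ∈ Finset.range J, ⋂ m ∈ Finset.range (n j),
        (V m ∪ {z | min (β m) ((1 / 2) ^ j) < dist z x})) :=
    (hfar _).inter (isOpen_biInter_finset fun j _ => isOpen_biInter_finset fun m _ =>
      (hV m).union (hfar _))
  refine mem_of_superset (hN.mem_nhds ⟨half_lt_self hyx, ?_⟩) fun z hz => ⟨?_, ?_⟩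
  · have h2 := hy.2
    simp only [mem_iInter] at h2
    simp only [mem_iInter]
    exact fun j _ m hm => h2 j m (Finset.mem_range.1 hm)
  · rintro rfl
    have h1 : dist y z / 2 < dist z z := hz.1
    rw [dist_self] at h1
    linarith
  · have h2 := hz.2
    simp only [mem_iInter] at h2
    simp only [mem_iInter]
    intro j m hm
    rcases lt_or_ge j J with hj | hj
    · exact h2 j (Finset.mem_range.2 hj) m (Finset.mem_range.2 hm)
    · refine Or.inr ?_
      have h1 : dist y x / 2 < dist z x := hz.1
      have h3 : (1 / 2 : ℝ) ^ j ≤ (1 / 2) ^ J :=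
        pow_le_pow_of_le_one (by norm_num) (by norm_num) hj
      exact (min_le_right _ _).trans_lt ((h3.trans_lt hJ).trans h1)

/-- If `r < β m` and `r ≤ 2 ^ (-j)`, a point of `B(x, r)` fails the distance alternative and must
lie in `V m`. -/
theorem ballCap_scaleOpen_le (W : IsExponentWeight p ϑ a b)
    {e : ℕ → ℚ × ℚ × ℚ} {V : ℕ → Set (EuclideanSpace ℝ (Fin d))} (hV : ∀ m, IsOpen (V m))
    (hcap : ∀ m, IsControlled p ϑ A x (e m).1 (e m).2.1 (ENNReal.ofReal (e m).2.2) →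
      capOpen p ϑ (V m) (Metric.ball x (2 * ((e m).1 : ℝ))) ≤ ENNReal.ofReal (e m).2.2)
    (n : ℕ → ℕ) {j : ℕ} {r : ℝ} (hr : 0 ≤ r) (hrj : r ≤ (1 / 2) ^ j) :
    ballCap p ϑ (scaleOpen x V (fun m => ((e m).2.1 : ℝ)) n) x r
      ≤ finiteBound p ϑ A x e (n j) r := by
  refine le_iInf₂ fun m hm => ?_
  unfold tripleBound
  split_ifs with h
  · refine ballCap_le_of_subset W (hV m) h.2.1 hr (fun y hy => ?_) (hcap m h.1)
    have h2 := hy.1.2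
    simp only [mem_iInter] at h2
    rcases h2 j m hm with h3 | h3
    · exact h3
    · have h4 : dist y x < r := hy.2
      have h5 : min ((e m).2.1 : ℝ) ((1 / 2) ^ j) < dist y x := h3
      exact absurd h5 (not_lt.2 (le_min (h4.trans h.2.2).le (h4.le.trans hrj)))
  · exact le_top

theorem iUnion_dyadic_Ioc : ⋃ j : ℕ, Ioc ((1 / 2 : ℝ) ^ (j + 1)) ((1 / 2) ^ j) ∩ Ioo 0 1
    = Ioo (0 : ℝ) 1 := by
  refine subset_antisymm (iUnion_subset fun j => inter_subset_right) fun r hr => ?_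
  obtain ⟨j, hj⟩ := exists_nat_pow_near_of_lt_one hr.1 hr.2.le (show (0 : ℝ) < 1 / 2 by norm_num)
    (by norm_num)
  exact mem_iUnion.2 ⟨j, hj, hr⟩

theorem pairwise_disjoint_dyadic_Ioc : Pairwise (Function.onFun Disjoint fun j : ℕ =>
    Ioc ((1 / 2 : ℝ) ^ (j + 1)) ((1 / 2) ^ j) ∩ Ioo 0 1) := fun i j hij =>
  have hanti : Antitone fun j : ℕ => (1 / 2 : ℝ) ^ j :=
    fun _ _ h => pow_le_pow_of_le_one (by norm_num) (by norm_num) h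
  (hanti.pairwise_disjoint_on_Ioc_succ hij).mono inter_subset_left inter_subset_left

/-- A set that is thin at a point outside it has an open neighbourhood that is thin there and
omits the point. -/
theorem IsThin.exists_isOpen (W : IsExponentWeight p ϑ a b) [NeZero d] (hx : x ∉ A)
    (hA : IsThin p ϑ A x) :
    ∃ U, IsOpen U ∧ A ⊆ U ∧ IsThin p ϑ U x ∧ x ∉ U := by
  obtain ⟨e, he⟩ := exists_surjective_nat (ℚ × ℚ × ℚ)
  have hκ : 0 ≤ 1 / (p x - 1) := one_div_nonneg.2 (sub_nonneg.2 (W.one_lt_exponent x).le)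
  set κ := 1 / (p x - 1) with hκ_def
  set I : ℕ → Set ℝ := fun j => Ioc ((1 / 2 : ℝ) ^ (j + 1)) ((1 / 2) ^ j) ∩ Ioo 0 1
  have hI : ∀ j, MeasurableSet (I j) := fun j => measurableSet_Ioc.inter measurableSet_Ioo
  have hIU : ⋃ j, I j = Ioo (0 : ℝ) 1 := iUnion_dyadic_Ioc
  have hsplit : ∀ E, wienerIntegral p ϑ E x
      = ∑' j, ∫⁻ r in I j, capRatio p ϑ E x r ^ κ * ENNReal.ofReal (1 / r) := fun E => by
    rw [wienerIntegral, ← hIU, lintegral_iUnion hI pairwise_disjoint_dyadic_Ioc]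
  have hsum : ∑' j, ∫⁻ r in I j, capRatio p ϑ A x r ^ κ * ENNReal.ofReal (1 / r) < ∞ :=
    hsplit A ▸ hA
  -- The error allowed on the `j`-th shell is `2⁻¹ ^ j`, so the total error is finite.
  have hn : ∀ j, ∃ n, ∫⁻ r in I j,
      cappedRatio p ϑ x (finiteBound p ϑ A x e n r) r ^ κ * ENNReal.ofReal (1 / r)
        ≤ (∫⁻ r in I j, capRatio p ϑ A x r ^ κ * ENNReal.ofReal (1 / r)) + 2⁻¹ ^ j := fun j =>
    exists_finiteBound_lintegral_le W he hκ (hI j) (l := (1 / 2) ^ (j + 1)) (by positivity)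
      (fun r hr => ⟨hr.1.1, hr.2.2⟩) (pow_ne_zero _ (by simp)) (ENNReal.ne_top_of_tsum_ne_top hsum.ne j)
  choose n hn using hn
  have hV : ∀ m, ∃ V : Set (EuclideanSpace ℝ (Fin d)), IsOpen V ∧
      A ∩ Metric.closedBall x ((e m).2.1 : ℝ) ⊆ V ∧
      (IsControlled p ϑ A x (e m).1 (e m).2.1 (ENNReal.ofReal (e m).2.2) →
        capOpen p ϑ V (Metric.ball x (2 * ((e m).1 : ℝ))) ≤ ENNReal.ofReal (e m).2.2) := fun m => by
    by_cases h : IsControlled p ϑ A x (e m).1 (e m).2.1 (ENNReal.ofReal (e m).2.2)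
    · obtain ⟨V, h1, h2, h3⟩ := h
      exact ⟨V, h1, h2, fun _ => h3⟩
    -- A triple without control has `tripleBound` equal to `∞`, so it may impose no condition on
    -- `U`.
    · exact ⟨univ, isOpen_univ, subset_univ _, fun h' => absurd h' h⟩
  choose V hVo hVA hVc using hV
  refine ⟨scaleOpen x V (fun m => ((e m).2.1 : ℝ)) n, isOpen_scaleOpen hVo _ n,
    fun y hy => ⟨fun hyx => hx (mem_singleton_iff.1 hyx ▸ hy), ?_⟩, ?_, fun h => h.1 rfl⟩
  · simp only [mem_iInter]
    intro j m _
    rcases le_or_gt (dist y x) (min ((e m).2.1 : ℝ) ((1 / 2) ^ j)) with h | h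
    · exact Or.inl (hVA m ⟨hy, h.trans (min_le_left _ _)⟩)
    · exact Or.inr h
  · rw [IsThin, hsplit]
    have hterm : ∀ j, ∫⁻ r in I j, capRatio p ϑ (scaleOpen x V (fun m => ((e m).2.1 : ℝ)) n) x r ^ κ *
        ENNReal.ofReal (1 / r)
        ≤ (∫⁻ r in I j, capRatio p ϑ A x r ^ κ * ENNReal.ofReal (1 / r)) + 2⁻¹ ^ j := fun j => by
      refine le_trans (setLIntegral_mono' (hI j) fun r hr => ?_) (hn j)
      rw [capRatio_eq_cappedRatio]
      gcongr
      exact cappedRatio_mono x r (ballCap_scaleOpen_le W hVo hVc n hr.2.1.le hr.1.2)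
    refine (ENNReal.tsum_le_tsum hterm).trans_lt ?_
    rw [ENNReal.tsum_add, ENNReal.add_lt_top]
    refine ⟨hsum, ?_⟩
    rw [ENNReal.tsum_geometric]
    simp

end VarCap

theorem mainTheorem6 (d : ℕ) (p ϑ : EuclideanSpace ℝ (Fin d) → ℝ)
    (hp : Measurable p) (hp_one : 1 < VarCap.pMinus p)
    (hp_lower : ∀ y, VarCap.pMinus p ≤ p y) (hp_upper : ∀ y, p y ≤ VarCap.pPlus p)
    (hϑ : Measurable ϑ) (hϑ_pos : ∀ y, 0 < ϑ y) (hϑ_loc : LocallyIntegrable ϑ volume)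
    (hϑ_dual : LocallyIntegrable (fun y => ϑ y ^ (-(1 / (p y - 1)))) volume)
    (A : Set (EuclideanSpace ℝ (Fin d))) (x₀ : EuclideanSpace ℝ (Fin d)) (r s : ℝ)
    (hr : 0 < r) (hrs : r ≤ s) (hs : s ≤ 2 * r)
    (hA : A ⊆ Metric.ball x₀ r)
    (hcap : 1 ≤ VarCap.relCap p ϑ A (Metric.ball x₀ (4 * r)))
    (x : EuclideanSpace ℝ (Fin d)) (hx : x ∈ closure A \ A)
    (hthin : VarCap.IsThin p ϑ A x) :
    ∃ U : Set (EuclideanSpace ℝ (Fin d)),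
      IsOpen U ∧ A ⊆ U ∧ VarCap.IsThin p ϑ U x ∧ x ∉ U := by
  -- In dimension `0` a nonempty `A` is the whole space, so no `x` exists. Positive dimension
  -- supplies the unit vector used in `integral_sq_le`.
  have hd : d ≠ 0 := by
    rintro rfl
    obtain ⟨y, hy⟩ := closure_nonempty_iff.1 ⟨x, hx.1⟩
    exact hx.2 (Subsingleton.elim y x ▸ hy)
  have : NeZero d := ⟨hd⟩
  exact hthin.exists_isOpen
    ⟨hp, hp_one, hp_lower, hp_upper, hϑ, hϑ_pos, hϑ_loc, hϑ_dual⟩ hx.2
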